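/- Let $N>1$ be an integer, $s<-1$ and $1\le p<\infty$. For $t\in\mathbb{R}$ and $1\le q\le\infty$ let $$L^q_t:=\{f\in L^q_{loc}(\mathbb{R}^N):(1+|x|)^{-t-N/q}f\in L^q(\mathbb{R}^N)\},\qquad \|f\|_{L^q_t}:=\|(1+|x|)^{-t-N/q}f\|_{L^q(\mathbb{R}^N)}$$ (real-valued functions, with $N/\infty:=0$). Let $I_{1,p}:=[p,Np/(N-p)]$ if $p<N$, $I_{1,p}:=[p,\infty)$ if $p=N$, and $I_{1,p}:=[p,\infty]$ if $p>N$. If $u\in\mathcal{D}'(\mathbb{R}^N)$ is a real distribution whose distributional gradient satisfies $\nabla u\in(L^p_s)^N$, then: (i) There is a unique constant $c_u\in\mathbb{R}$ such that $u-c_u\in L^p_{s+1}$, and there is a constant $C>0$, depending only on $N,s,p$ and not on $u$, such that $$\|u-c_u\|_{L^p_{s+1}}\le C\,\|\,|\nabla u|\,\|_{L^p_s}.$$ (ii) If also $u$ is radially symmetric (i.e. $u$ is a locally integrable function that coincides almost everywhere with a function of $|x|$), then for every $q\in I_{1,p}$ the constant $c_u$ of (i) is the unique constant such that $u-c_u\in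 L^q_{s+1}$, and there is a constant $C>0$, depending only on $N,s,p,q$ and not on $u$, such that $$\|u-c_u\|_{L^q_{s+1}}\le C\,\|\,|\nabla u|\,\|_{L^p_s}.$$ Furthermore, if $p>N$ (so that $\infty\in I_{1,p}$), then $u$ is (almost everywhere equal to) a continuous function and, for this continuous representative, $\lim_{|x|\to\infty}|x|^{-(s+1)}(u(x)-c_u)=0$. -/

import Mathlib

open MeasureTheory TopologicalSpace Filter
open scoped Distributions LineDeriv ENNReal Topology

/-- The Euclidean space `ℝ^N`. -/
abbrev RN (N : ℕ) : Type := EuclideanSpace ℝ (Fin N)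

/-- Real distributions on the whole of `ℝ^N`. -/
abbrev Distr (N : ℕ) : Type := 𝓓'((⊤ : Opens (RN N)), ℝ)

/-- The weight `(1 + |x|)^(-s - N/q)`. For `q = ∞` one has `q.toReal = 0`, hence `N/q = 0`. -/
noncomputable def growthWeight (N : ℕ) (s : ℝ) (q : ℝ≥0∞) (x : RN N) : ℝ :=
  (1 + ‖x‖) ^ (-s - (N : ℝ) / q.toReal)

/-- The function `f` belongs to `L^q_s = {f ∈ L^q_loc : (1 + |x|)^(-s - N/q) f ∈ L^q}`. -/
def FunMemL {N : ℕ} (s : ℝ) (q : ℝ≥0∞) (f : RN N → ℝ) : Prop :=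
  (∀ K : Set (RN N), IsCompact K → MemLp f q (volume.restrict K)) ∧
    MemLp (fun x => growthWeight N s q x * f x) q volume

/-- The norm `‖f‖_{L^q_s} = ‖(1 + |x|)^(-s - N/q) f‖_q` of a function, as an extended real. -/
noncomputable def funNormL {N : ℕ} (s : ℝ) (q : ℝ≥0∞) (f : RN N → ℝ) : ℝ≥0∞ :=
  eLpNorm (fun x => growthWeight N s q x * f x) q volume

/-- The distribution `φ ↦ ∫ φ f` defined by a function `f`
(used only for locally integrable `f`). -/
noncomputable def distrOfFun {N : ℕ} (f : RN N → ℝ) : Distr N :=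
  (TestFunction.integralAgainstBilinCLM (𝕜 := ℝ) (ContinuousLinearMap.mul ℝ ℝ) volume f :
    𝓓((⊤ : Opens (RN N)), ℝ) →L[ℝ] ℝ)

/-- The distribution `T` is the locally integrable function `f`. -/
def Represents {N : ℕ} (T : Distr N) (f : RN N → ℝ) : Prop :=
  LocallyIntegrable f volume ∧ T = distrOfFun f

/-- The distribution `T` belongs to `L^q_s`. -/
def MemL {N : ℕ} (s : ℝ) (q : ℝ≥0∞) (T : Distr N) : Prop :=
  ∃ f : RN N → ℝ, Represents T f ∧ FunMemL s q f

/-- The norm `‖T‖_{L^q_s}` of a distribution: it is `funNormL s q f` if `T` is the locally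
integrable function `f` (see `normL_eq`), and `∞` if `T` is not a locally integrable function. -/
noncomputable def normL {N : ℕ} (s : ℝ) (q : ℝ≥0∞) (T : Distr N) : ℝ≥0∞ :=
  ⨅ (f : RN N → ℝ) (_ : Represents T f), funNormL s q f

/-- The distributional gradient of `u` is the locally integrable vector field `g`. -/
def GradRepresents {N : ℕ} (u : Distr N) (g : RN N → RN N) : Prop :=
  ∀ i : Fin N, Represents (∂_{(EuclideanSpace.single i (1 : ℝ) : RN N)} u) (fun x => g x i)

/-- `∇u ∈ (L^p_s)^N`, for the distributional gradient of `u`. -/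
def GradMemL {N : ℕ} (s : ℝ) (p : ℝ≥0∞) (u : Distr N) : Prop :=
  ∀ i : Fin N, MemL s p (∂_{(EuclideanSpace.single i (1 : ℝ) : RN N)} u)

/-- The norm `‖ |∇u| ‖_{L^p_s}`, where `|∇u|` is the Euclidean norm of the gradient: it is
`funNormL s p |g|` if the distributional gradient of `u` is the locally integrable vector field
`g` (see `gradNormL_eq`), and `∞` if there is no such field. -/
noncomputable def gradNormL {N : ℕ} (s : ℝ) (p : ℝ≥0∞) (u : Distr N) : ℝ≥0∞ :=
  ⨅ (g : RN N → RN N) (_ : GradRepresents u g), funNormL s p (fun x => ‖g x‖)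

/-- The constant `c`, as a distribution. -/
noncomputable def constDistr (N : ℕ) (c : ℝ) : Distr N := distrOfFun (fun _ => c)

/-- `u` is a radially symmetric (locally integrable) function: up to a null set it is a function
of `|x|`. -/
def IsRadial {N : ℕ} (u : Distr N) : Prop :=
  ∃ h : ℝ → ℝ, Represents u (fun x => h ‖x‖)

/-- The exponent `p^* = Np/(N - p)` if `p < N`, and `p^* = ∞` otherwise. -/
noncomputable def sobolevExp (N : ℕ) (p : ℝ≥0∞) : ℝ≥0∞ :=
  open scoped Classical in if p < N then (N * p) / (N - p) else ∞

/-- The interval `I_{1,p}`: it is `[p, p^*]` if `p ≠ N` or `p = N = 1`, and `[p, ∞)` if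
`p = N > 1`. -/
noncomputable def sobolevInterval (N : ℕ) (p : ℝ≥0∞) : Set ℝ≥0∞ :=
  open scoped Classical in
  if p ≠ N ∨ N = 1 then Set.Icc p (sobolevExp N p) else Set.Ico p ∞

theorem Represents.ae_eq {N : ℕ} {T : Distr N} {f g : RN N → ℝ}
    (hf : Represents T f) (hg : Represents T g) : f =ᵐ[volume] g := by
  refine ae_eq_of_integral_contDiff_smul_eq hf.1 hg.1 fun φ hφ hc => ?_
  let ψ : 𝓓((⊤ : Opens (RN N)), ℝ) := ⟨φ, by simpa using hφ, hc, by simp⟩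
  have h : distrOfFun f ψ = distrOfFun g ψ := by rw [← hf.2, ← hg.2]
  have key : ∀ {k : RN N → ℝ}, LocallyIntegrable k volume →
      distrOfFun k ψ = ∫ x, φ x • k x := by
    intro k hk
    exact TestFunction.integralAgainstBilinCLM_eq_integral (Ω := (⊤ : Opens (RN N)))
      (by simpa using hk.locallyIntegrableOn Set.univ)
  rwa [key hf.1, key hg.1] at h

theorem normL_eq {N : ℕ} {T : Distr N} {f : RN N → ℝ} (hf : Represents T f)
    (s : ℝ) (q : ℝ≥0∞) : normL s q T = funNormL s q f := by
  refine le_antisymm (iInf₂_le f hf) (le_iInf₂ fun g hg => le_of_eq ?_)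
  refine eLpNorm_congr_ae ?_
  filter_upwards [hf.ae_eq hg] with x hx
  rw [hx]

theorem gradNormL_eq {N : ℕ} {u : Distr N} {g : RN N → RN N} (hg : GradRepresents u g)
    (s : ℝ) (p : ℝ≥0∞) : gradNormL s p u = funNormL s p (fun x => ‖g x‖) := by
  refine le_antisymm (iInf₂_le g hg) (le_iInf₂ fun k hk => le_of_eq ?_)
  refine eLpNorm_congr_ae ?_
  have : ∀ᵐ x ∂(volume : Measure (RN N)), ∀ i, g x i = k x i :=
    ae_all_iff.2 fun i => (hg i).ae_eq (hk i)
  filter_upwards [this] with x hx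
  rw [show g x = k x from PiLp.ext hx]

/-! ### Dilations and Jensen's inequality -/

section ScalingAndMeans

/-! Let `g` be the gradient of `u`, `P` the finite exponent and `a = -s - N/P`, so that `(1 + |x|)^a
g` is in `L^P` and `a + N/P = -s > 1`. This decay lets `g` be integrated from infinity along rays:
put `v(x) = -∫_1^∞ x · g(t x) dt` (`rayPrimitive`), dominated by `rayTail |g|`. Everything follows
from the identity `u = v + c` and from bounds on the two tails `rayTail` and `radialTail`.

Hardy inequality (`exists_lintegral_rayTail_rpow_le`). `rayTail` is a superposition of dilations, so
Jensen in `t`, Fubini and the substitution `y = t x` bound it in `L^P` with weight `|x|^(-θ) (1 +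
|x|)^(a-1+θ)`. The case `θ = 0` is the estimate of (i).

Identification (`GradRepresents.exists_sub_const_eq`). Let `φ_T(y) = T^(-N) φ(y/T)`. The difference
`φ - φ_T` is an explicit divergence, and pairing it with `u` gives `u(φ) - u(φ_T) → ∫ φ v`. If `φ`
has mean zero, it is a divergence `div Ψ`, and `u(φ_T)` is a sum of terms of size `T^(1-N) ∫
|Ψ_i(y/T)| |g|`, which tend to `0` because `N > 1` and `|y|^(1-N) |g|` is integrable at infinity.
Hence `u - v` vanishes on mean-zero test functions and is a constant. It is unique because `s + 1 <
0` excludes nonzero constants from the weighted space.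

Radial case. If `u` is radial, so is `v`, which then equals its spherical mean, and that mean is
bounded by `radialTail |g| |x|`. Averaging the Hardy inequality over a dyadic shell bounds
`radialTail` pointwise. Writing `|v|^Q = |v|^(Q-P) |v|^P`, with the pointwise bound on the first
factor and Hardy with `θ = N/P - N/Q` on the second, gives all finite `Q` with `θ ≤ 1`. For `P > N`,
Hölder makes the tail finite down to radius `0`, whence the sup bound and continuity; the limit at
infinity holds because the tail only sees the energy outside a ball. -/

theorem lintegral_comp_smul_eq {N : ℕ} (F : RN N → ℝ≥0∞) {t : ℝ} (ht : 0 < t) :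
    ∫⁻ x, F (t • x) = ENNReal.ofReal ((t ^ N)⁻¹) * ∫⁻ x, F x := by
  calc
    ∫⁻ x, F (t • x) = ∫⁻ y, F y ∂Measure.map (fun x => t • x) volume :=
      (lintegral_map_equiv F (Homeomorph.smul
        (isUnit_iff_ne_zero.2 ht.ne').unit).toMeasurableEquiv).symm
    _ = _ := by
      rw [Measure.map_addHaar_smul volume ht.ne', lintegral_smul_measure, smul_eq_mul,
        finrank_euclideanSpace_fin, abs_of_pos (by positivity)]

/-- Hölder against the constant `1`. It serves as Jensen's inequality for finite measures that are
not normalised: dilation parameters, dyadic shells, compact sets. -/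
theorem rpow_lintegral_le {α : Type*} [MeasurableSpace α] {μ : Measure α} {P : ℝ} (hP : 1 ≤ P)
    {f : α → ℝ≥0∞} (hf : AEMeasurable f μ) :
    (∫⁻ x, f x ∂μ) ^ P ≤ μ Set.univ ^ (P - 1) * ∫⁻ x, f x ^ P ∂μ := by
  have hP0 : 0 < P := by linarith
  rcases eq_or_lt_of_le hP with rfl | hP1
  · simp
  have hpq : P.HolderConjugate (Real.conjExponent P) := Real.HolderConjugate.conjExponent hP1
  have h := ENNReal.lintegral_mul_le_Lp_mul_Lq μ hpq hf (aemeasurable_const (b := (1 : ℝ≥0∞)))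
  simp only [Pi.mul_apply, mul_one, ENNReal.one_rpow, lintegral_const, one_mul] at h
  calc (∫⁻ x, f x ∂μ) ^ P
      ≤ ((∫⁻ x, f x ^ P ∂μ) ^ (1 / P) * μ Set.univ ^ (1 / Real.conjExponent P)) ^ P := by
        gcongr
    _ = μ Set.univ ^ (P - 1) * ∫⁻ x, f x ^ P ∂μ := by
        rw [ENNReal.mul_rpow_of_nonneg _ _ hP0.le, ← ENNReal.rpow_mul, ← ENNReal.rpow_mul,
          one_div_mul_cancel hP0.ne', ENNReal.rpow_one, mul_comm]
        congr 2
        rw [Real.conjExponent]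
        field_simp

end ScalingAndMeans

/-! ### Weighted Hardy inequality along rays -/

section Hardy

/-- The integral of `|x| G(t x)` over `t > 1`, that is, the integral of `G` along the half-line
issuing from `x` in the direction of `x`. -/
noncomputable def rayTail {N : ℕ} (G : RN N → ℝ≥0∞) (x : RN N) : ℝ≥0∞ :=
  ∫⁻ t in Set.Ioi (1 : ℝ), ‖x‖ₑ * G (t • x)

theorem measurable_rayTail {N : ℕ} {G : RN N → ℝ≥0∞} (hG : Measurable G) :
    Measurable (rayTail G) := by
  unfold rayTail
  apply Measurable.lintegral_prod_right'
    (f := fun z : RN N × ℝ => ‖z.1‖ₑ * G (z.2 • z.1))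
  fun_prop

/-- Compares the weight at `x` (with `r = |x|`) with the weight at `t x`, leaving the gain
`t^(δ-d)`. The two upper bounds on `δ - d` reflect large `r`, where the ratio of weights behaves
like `t^a`, and small `r`, where only the factor `r^(1-θ)` helps. -/
theorem dilation_kernel_le {a θ δ d r t : ℝ} (hθ1 : θ ≤ 1)
    (h1 : δ - d ≤ a) (h2 : δ - d ≤ 1 - θ) (hr : 0 ≤ r) (ht : 1 ≤ t) :
    t ^ δ * (r ^ (-θ) * (1 + r) ^ (a - 1 + θ) * r) ≤ (1 + t * r) ^ a * t ^ d := by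
  have ht0 : 0 < t := by linarith
  rcases eq_or_lt_of_le hr with rfl | hr0
  · simp; positivity
  set b := δ - d with hb
  set lam := (1 + t * r) / (1 + r) with hlam
  set ρ := r / (1 + r) with hρ
  have hρ0 : 0 < ρ := by positivity
  have hρ1 : ρ ≤ 1 := by rw [hρ, div_le_one (by positivity)]; linarith
  have hlam1 : 1 ≤ lam := by rw [hlam, le_div_iff₀ (by positivity)]; nlinarith
  have hlamt : lam ≤ t := by rw [hlam, div_le_iff₀ (by positivity)]; nlinarith
  have hlamρ : t * ρ ≤ lam := by
    rw [hlam, hρ, ← mul_div_assoc]; gcongr; linarith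
  -- This is the claim divided by `(1 + r)^a t^d`. The ratio `lam` lies between `max 1 (t ρ)` and
  -- `t`; the lower bound is used when `b ≥ 0` and the upper one when `b ≤ 0`.
  have key : t ^ b * ρ ^ (1 - θ) ≤ lam ^ a := by
    refine le_trans ?_ (Real.rpow_le_rpow_of_exponent_le hlam1 h1)
    rcases le_total 0 b with hb0 | hb0
    · calc t ^ b * ρ ^ (1 - θ) ≤ t ^ b * ρ ^ b := by
            gcongr t ^ b * ?_
            exact Real.rpow_le_rpow_of_exponent_ge hρ0 hρ1 h2
        _ = (t * ρ) ^ b := (Real.mul_rpow ht0.le hρ0.le).symm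
        _ ≤ lam ^ b := Real.rpow_le_rpow (by positivity) hlamρ hb0
    · calc t ^ b * ρ ^ (1 - θ) ≤ t ^ b * 1 := by
            gcongr; exact Real.rpow_le_one hρ0.le hρ1 (by linarith)
        _ = t ^ b := mul_one _
        _ ≤ lam ^ b := Real.rpow_le_rpow_of_nonpos (by linarith) hlamt hb0
  have e1 : r ^ (-θ) * (1 + r) ^ (a - 1 + θ) * r = ρ ^ (1 - θ) * (1 + r) ^ a := by
    rw [hρ, Real.div_rpow hr (by positivity)]
    rw [show a - 1 + θ = a - (1 - θ) by ring, Real.rpow_sub (by positivity : 0 < 1 + r),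
      show r ^ (1 - θ) = r ^ (-θ) * r by
        rw [show 1 - θ = -θ + 1 by ring, Real.rpow_add_one hr0.ne']]
    field_simp
  have e2 : (1 + t * r) ^ a = lam ^ a * (1 + r) ^ a := by
    rw [← Real.mul_rpow (by positivity) (by positivity), hlam, div_mul_cancel₀ _ (by positivity)]
  have e3 : t ^ δ = t ^ b * t ^ d := by rw [← Real.rpow_add ht0, hb]; ring_nf
  rw [e1, e2, e3]
  have := mul_le_mul_of_nonneg_right key (by positivity : 0 ≤ (1 + r) ^ a * t ^ d)
  linarith

theorem lintegral_Ioi_one_rpow {δ : ℝ} (hδ : 1 < δ) :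
    ∫⁻ t in Set.Ioi (1 : ℝ), ENNReal.ofReal (t ^ (-δ)) = ENNReal.ofReal (1 / (δ - 1)) := by
  rw [← ofReal_integral_eq_lintegral_ofReal
    (integrableOn_Ioi_rpow_of_lt (by linarith) one_pos)
    (by filter_upwards [ae_restrict_mem measurableSet_Ioi] with t ht
        exact Real.rpow_nonneg (by linarith [Set.mem_Ioi.1 ht]) _),
    integral_Ioi_rpow_of_lt (by linarith) one_pos]
  congr 1
  rw [Real.one_rpow, neg_div, ← one_div_neg_eq_neg_one_div]; ring_nf

theorem exists_lintegral_rayTail_rpow_le (N : ℕ) {a θ P : ℝ} (hP : 1 ≤ P) (hθ1 : θ ≤ 1)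
    (hθ : θ < N / P) (ha : 1 < a + N / P) :
    ∃ C : ℝ, 0 < C ∧ ∀ G : RN N → ℝ≥0∞, Measurable G →
      ∫⁻ x, (ENNReal.ofReal (‖x‖ ^ (-θ) * (1 + ‖x‖) ^ (a - 1 + θ)) * rayTail G x) ^ P
        ≤ ENNReal.ofReal C * ∫⁻ x, (ENNReal.ofReal ((1 + ‖x‖) ^ a) * G x) ^ P := by
  have hP0 : 0 < P := by linarith
  set d : ℝ := N / P with hd
  -- The largest exponent that the kernel bound allows. The hypotheses on `a` and `θ` say exactly
  -- that both entries exceed `1`, so that `t^(-δ)` is integrable at infinity.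
  set δ : ℝ := min (a + d) (1 - θ + d) with hδ
  have hδ1 : 1 < δ := lt_min ha (by linarith)
  have hδa : δ - d ≤ a := by have := min_le_left (a + d) (1 - θ + d); linarith
  have hδθ : δ - d ≤ 1 - θ := by have := min_le_right (a + d) (1 - θ + d); linarith
  set κ : ℝ := 1 / (δ - 1) with hκ
  have hκ0 : 0 < κ := by have : 0 < δ - 1 := by linarith
                         positivity
  refine ⟨κ ^ (P - 1) * κ, by positivity, fun G hG => ?_⟩
  -- Jensen needs a finite measure in `t`: the density `t^(-δ)` is split off and the compensating
  -- `t^δ` stays in the integrand, where the kernel bound absorbs it.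
  set μ : Measure ℝ := (volume.restrict (Set.Ioi (1 : ℝ))).withDensity
    fun t => ENNReal.ofReal (t ^ (-δ)) with hμ
  have hmeas : Measurable fun t : ℝ => ENNReal.ofReal (t ^ (-δ)) := by fun_prop
  have hμuniv : μ Set.univ = ENNReal.ofReal κ := by
    rw [hμ, withDensity_apply _ MeasurableSet.univ, Measure.restrict_univ,
      lintegral_Ioi_one_rpow hδ1]
  set W : RN N → ℝ := fun x => ‖x‖ ^ (-θ) * (1 + ‖x‖) ^ (a - 1 + θ) with hW
  have hW0 : ∀ x, 0 ≤ W x := fun x => by positivity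
  set H : RN N → ℝ≥0∞ := fun y => ENNReal.ofReal ((1 + ‖y‖) ^ a) * G y with hH
  have hHm : Measurable H := by fun_prop
  have hpt : ∀ x, (ENNReal.ofReal (W x) * rayTail G x) ^ P ≤
      ENNReal.ofReal (κ ^ (P - 1)) * ∫⁻ t in Set.Ioi (1 : ℝ),
        ENNReal.ofReal (t ^ (-δ)) * (ENNReal.ofReal (t ^ (N : ℝ)) * H (t • x) ^ P) := by
    intro x
    have h1 : ENNReal.ofReal (W x) * rayTail G x =
        ∫⁻ t, ENNReal.ofReal (t ^ δ * (W x * ‖x‖)) * G (t • x) ∂μ := by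
      rw [hμ, lintegral_withDensity_eq_lintegral_mul _ hmeas (by fun_prop), rayTail,
        ← lintegral_const_mul _ (by fun_prop)]
      refine setLIntegral_congr_fun measurableSet_Ioi fun t ht => ?_
      have ht0 : 0 < t := lt_trans one_pos ht
      simp only [Pi.mul_apply]
      rw [← mul_assoc, ← mul_assoc, ← ENNReal.ofReal_mul (by positivity), ← mul_assoc,
        ← Real.rpow_add ht0, neg_add_cancel, Real.rpow_zero, one_mul,
        ENNReal.ofReal_mul (hW0 x), ofReal_norm]
    rw [h1]
    refine (rpow_lintegral_le hP (by fun_prop)).trans ?_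
    rw [hμuniv, ENNReal.ofReal_rpow_of_pos hκ0, hμ,
      lintegral_withDensity_eq_lintegral_mul _ hmeas (by fun_prop)]
    gcongr _ * ?_
    refine setLIntegral_mono' measurableSet_Ioi fun t ht => ?_
    have ht1 : 1 ≤ t := le_of_lt ht
    have ht0 : 0 < t := lt_trans one_pos ht
    simp only [Pi.mul_apply]
    gcongr _ * ?_
    have hk := dilation_kernel_le hθ1 hδa hδθ (norm_nonneg x) ht1
    calc (ENNReal.ofReal (t ^ δ * (W x * ‖x‖)) * G (t • x)) ^ P
        ≤ (ENNReal.ofReal ((1 + t * ‖x‖) ^ a * t ^ d) * G (t • x)) ^ P := by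
          gcongr
      _ = (ENNReal.ofReal (t ^ d) * H (t • x)) ^ P := by
          have : ‖t • x‖ = t * ‖x‖ := by rw [norm_smul, Real.norm_of_nonneg ht0.le]
          simp only [hH, this]
          rw [mul_comm ((1 + t * ‖x‖) ^ a), ENNReal.ofReal_mul (by positivity), mul_assoc]
      _ = _ := by
          rw [ENNReal.mul_rpow_of_nonneg _ _ hP0.le, ENNReal.ofReal_rpow_of_pos (by positivity),
            ← Real.rpow_mul ht0.le, hd, div_mul_cancel₀ _ hP0.ne']
  calc ∫⁻ x, (ENNReal.ofReal (W x) * rayTail G x) ^ P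
      ≤ ∫⁻ x, ENNReal.ofReal (κ ^ (P - 1)) * ∫⁻ t in Set.Ioi (1 : ℝ),
        ENNReal.ofReal (t ^ (-δ)) * (ENNReal.ofReal (t ^ (N : ℝ)) * H (t • x) ^ P) :=
        lintegral_mono hpt
    _ = ENNReal.ofReal (κ ^ (P - 1)) * ∫⁻ t in Set.Ioi (1 : ℝ), ∫⁻ x : RN N,
        ENNReal.ofReal (t ^ (-δ)) * (ENNReal.ofReal (t ^ (N : ℝ)) * H (t • x) ^ P) := by
        rw [lintegral_const_mul' _ _ ENNReal.ofReal_ne_top, lintegral_lintegral_swap]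
        apply Measurable.aemeasurable
        simp only [Function.uncurry_def]
        fun_prop
    -- The substitution `y = t x` costs `t^(-N)`, which cancels `t^N = (t^d)^P`; this is why `d = N
    -- / P`.
    _ = ENNReal.ofReal (κ ^ (P - 1)) * ∫⁻ t in Set.Ioi (1 : ℝ),
        ENNReal.ofReal (t ^ (-δ)) * ∫⁻ x, H x ^ P := by
        congr 1
        refine setLIntegral_congr_fun measurableSet_Ioi fun t ht => ?_
        have ht0 : 0 < t := lt_trans one_pos ht
        rw [lintegral_const_mul' _ _ ENNReal.ofReal_ne_top,
          lintegral_const_mul' _ _ ENNReal.ofReal_ne_top,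
          lintegral_comp_smul_eq (fun y => H y ^ P) ht0, ← mul_assoc (ENNReal.ofReal (t ^ (N : ℝ))),
          ← ENNReal.ofReal_mul (by positivity), Real.rpow_natCast,
          mul_inv_cancel₀ (by positivity), ENNReal.ofReal_one, one_mul]
    _ = _ := by
        rw [lintegral_mul_const _ hmeas, lintegral_Ioi_one_rpow hδ1, ← mul_assoc,
          ← ENNReal.ofReal_mul (by positivity)]

end Hardy

/-! ### Pointwise bounds for the radial tail -/

section RadialTail

/-- The integral of `|y|^(1-N) G(y)` over `|y| > r`. -/
noncomputable def radialTail {N : ℕ} (G : RN N → ℝ≥0∞) (r : ℝ) : ℝ≥0∞ :=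
  ∫⁻ y in {y : RN N | r < ‖y‖}, ENNReal.ofReal (‖y‖ ^ (1 - (N : ℝ))) * G y

theorem measurableSet_lt_norm {N : ℕ} (r : ℝ) : MeasurableSet {y : RN N | r < ‖y‖} :=
  measurableSet_lt measurable_const measurable_norm

theorem radialTail_antitone {N : ℕ} (G : RN N → ℝ≥0∞) : Antitone (radialTail G) :=
  fun _ _ hrs => lintegral_mono_set fun _ hy => lt_of_le_of_lt hrs hy

/-- Fubini and `y = t x` turn the shell integral of `rayTail G` into an integral of `G` against a
kernel. A point with `|y| > r` is reached from the shell exactly for `t` in `[|y|/r, 2|y|/r)`, so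
its kernel is at least a multiple of `r^N |y|^(1-N)`. -/
theorem radialTail_le_lintegral_rayTail {N : ℕ} {G : RN N → ℝ≥0∞} (hG : Measurable G)
    {r : ℝ} (hr : 0 < r) :
    radialTail G r ≤ ENNReal.ofReal (2 ^ (N + 1) * (r ^ N)⁻¹) *
      ∫⁻ x in {x : RN N | r / 2 < ‖x‖ ∧ ‖x‖ ≤ r}, rayTail G x := by
  set S : Set (RN N) := {x : RN N | r / 2 < ‖x‖ ∧ ‖x‖ ≤ r} with hS
  have hSm : MeasurableSet S := (measurableSet_lt measurable_const measurable_norm).inter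
    (measurableSet_le measurable_norm measurable_const)
  have hind : Measurable (S.indicator (fun _ : RN N => (1 : ℝ≥0∞))) :=
    measurable_const.indicator hSm
  have h1 : ∫⁻ x in S, rayTail G x =
      ∫⁻ t in Set.Ioi (1 : ℝ), ∫⁻ x : RN N,
        S.indicator (fun _ => 1) x * (‖x‖ₑ * G (t • x)) := by
    rw [← lintegral_indicator hSm, ← lintegral_lintegral_swap]
    · refine lintegral_congr fun x => ?_
      by_cases hx : x ∈ S <;> simp [hx, rayTail]
    · apply Measurable.aemeasurable
      simp only [Function.uncurry_def]
      fun_prop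
  have h2 : ∫⁻ x in S, rayTail G x =
      ∫⁻ y : RN N, ∫⁻ t in Set.Ioi (1 : ℝ), ENNReal.ofReal ((t ^ N)⁻¹) *
        (S.indicator (fun _ => 1) (t⁻¹ • y) * (‖t⁻¹ • y‖ₑ * G y)) := by
    rw [h1]
    symm
    refine (lintegral_lintegral_swap ?_).trans ?_
    · apply Measurable.aemeasurable
      simp only [Function.uncurry_def]
      fun_prop
    · refine setLIntegral_congr_fun measurableSet_Ioi fun t ht => ?_
      have ht0 : 0 < t := lt_trans one_pos ht
      have := lintegral_comp_smul_eq
        (fun y : RN N => S.indicator (fun _ => 1) (t⁻¹ • y) * (‖t⁻¹ • y‖ₑ * G y)) ht0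
      simp only [smul_smul, inv_mul_cancel₀ ht0.ne', one_smul] at this
      rw [this, lintegral_const_mul' _ _ ENNReal.ofReal_ne_top]
  rw [h2, radialTail, ← lintegral_const_mul' _ _ ENNReal.ofReal_ne_top,
    ← lintegral_indicator (measurableSet_lt_norm r)]
  refine lintegral_mono fun y => ?_
  by_cases hy : y ∈ {y : RN N | r < ‖y‖}
  swap
  · simp [hy]
  rw [Set.indicator_of_mem hy]
  have hy' : r < ‖y‖ := hy
  have hy0 : 0 < ‖y‖ := hr.trans hy'
  have hsub : Set.Ico (‖y‖ / r) (2 * (‖y‖ / r)) ⊆ Set.Ioi (1 : ℝ) := fun t ht =>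
    lt_of_lt_of_le (by rwa [lt_div_iff₀ hr, one_mul]) ht.1
  -- On this interval of length `|y|/r` the integrand `t^(-N-1) |y|` is replaced by its infimum, at
  -- the right endpoint; integrating that constant gives back `|y|^(1-N)` exactly.
  calc ENNReal.ofReal (‖y‖ ^ (1 - (N : ℝ))) * G y
      = ENNReal.ofReal (2 ^ (N + 1) * (r ^ N)⁻¹) *
        ∫⁻ _ in Set.Ico (‖y‖ / r) (2 * (‖y‖ / r)),
          ENNReal.ofReal (((2 * (‖y‖ / r)) ^ (N + 1))⁻¹ * ‖y‖) * G y := by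
        rw [setLIntegral_const, Real.volume_Ico, mul_comm _ (ENNReal.ofReal (_ - _)), ← mul_assoc,
          ← mul_assoc, ← ENNReal.ofReal_mul (by positivity), ← ENNReal.ofReal_mul (by
            have : 0 ≤ 2 * (‖y‖ / r) - ‖y‖ / r := by
              have : 0 ≤ ‖y‖ / r := by positivity
              linarith
            positivity)]
        congr 2
        rw [Real.rpow_sub hy0, Real.rpow_one, Real.rpow_natCast, two_mul, add_sub_cancel_right,
          ← two_mul, mul_pow, div_pow, pow_succ ‖y‖, pow_succ r]
        field_simp
    _ ≤ ENNReal.ofReal (2 ^ (N + 1) * (r ^ N)⁻¹) *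
        ∫⁻ t in Set.Ico (‖y‖ / r) (2 * (‖y‖ / r)), ENNReal.ofReal ((t ^ N)⁻¹) *
        (S.indicator (fun _ => 1) (t⁻¹ • y) * (‖t⁻¹ • y‖ₑ * G y)) := by
        gcongr _ * ?_
        refine setLIntegral_mono' measurableSet_Ico fun t ht => ?_
        have ht0 : 0 < t := lt_trans one_pos (hsub ht)
        have hn : ‖t⁻¹ • y‖ = t⁻¹ * ‖y‖ := by
          rw [norm_smul, Real.norm_of_nonneg (by positivity)]
        have hmem : t⁻¹ • y ∈ S := by
          have h1 := ht.1
          have h2 := ht.2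
          rw [div_le_iff₀ hr] at h1
          rw [← mul_div_assoc, lt_div_iff₀ hr] at h2
          simp only [hS, Set.mem_ofPred_eq, hn]
          constructor
          · rw [inv_mul_eq_div, lt_div_iff₀ ht0]; linarith
          · rw [inv_mul_eq_div, div_le_iff₀ ht0]; linarith
        rw [Set.indicator_of_mem hmem, one_mul, ← ofReal_norm, hn, ← mul_assoc,
          ← ENNReal.ofReal_mul (by positivity)]
        gcongr ENNReal.ofReal ?_ * _
        rw [← mul_assoc]
        gcongr ?_ * _
        rw [← mul_inv, ← pow_succ]
        gcongr
        exact ht.2.le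
    _ ≤ _ := by
        gcongr

theorem radialTail_indicator {N : ℕ} (G : RN N → ℝ≥0∞) (r : ℝ) :
    radialTail ({y : RN N | r < ‖y‖}.indicator G) r = radialTail G r := by
  refine setLIntegral_congr_fun (measurableSet_lt_norm r) fun y hy => ?_
  simp only [Set.indicator_of_mem hy]

/-- The weight at `r` is comparable to the weight on the shell `r/2 < |x| ≤ r`, so Jensen on the
shell, whose volume is of order `r^N`, turns the previous mean into an `L^P` bound with the factor
`r^(N/P)`. -/
theorem exists_radialTail_rpow_le_lintegral_rayTail (N : ℕ) {θ b P : ℝ} (hP : 1 ≤ P)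
    (hθ0 : 0 ≤ θ) :
    ∃ C : ℝ, 0 < C ∧ ∀ G : RN N → ℝ≥0∞, Measurable G → ∀ r : ℝ, 0 < r →
      (ENNReal.ofReal (r ^ (N / P) * (r ^ (-θ) * (1 + r) ^ b)) * radialTail G r) ^ P ≤
        ENNReal.ofReal C *
          ∫⁻ x, (ENNReal.ofReal (‖x‖ ^ (-θ) * (1 + ‖x‖) ^ b) * rayTail G x) ^ P := by
  have hP0 : 0 < P := by linarith
  -- The `+ 1` makes positivity immediate; only an upper bound for the volume is needed.
  set ω : ℝ := (volume (Metric.ball (0 : RN N) 1)).toReal + 1 with hω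
  have hω0 : 0 < ω := by positivity
  set D : ℝ := 2 ^ (N + 1) * 2 ^ |b| with hD
  have hD0 : 0 < D := by positivity
  refine ⟨D ^ P * ω ^ (P - 1), by positivity, fun G hG r hr => ?_⟩
  set S : Set (RN N) := {x : RN N | r / 2 < ‖x‖ ∧ ‖x‖ ≤ r} with hS
  have hSm : MeasurableSet S := (measurableSet_lt measurable_const measurable_norm).inter
    (measurableSet_le measurable_norm measurable_const)
  have hSvol : volume S ≤ ENNReal.ofReal (r ^ N * ω) := by
    calc volume S ≤ volume (Metric.closedBall (0 : RN N) r) :=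
          measure_mono fun x hx => by simpa using hx.2
      _ = ENNReal.ofReal (r ^ N) * volume (Metric.ball (0 : RN N) 1) := by
          rw [Measure.addHaar_closedBall _ _ hr.le, finrank_euclideanSpace_fin]
      _ ≤ _ := by
          rw [ENNReal.ofReal_mul (by positivity)]
          gcongr
          rw [← ENNReal.ofReal_toReal (measure_ball_lt_top (μ := volume) (x := (0 : RN N))).ne]
          exact ENNReal.ofReal_le_ofReal (by linarith)
  set W : RN N → ℝ := fun x => ‖x‖ ^ (-θ) * (1 + ‖x‖) ^ b with hW
  have hWle : ∀ x ∈ S, r ^ (-θ) * (1 + r) ^ b ≤ 2 ^ |b| * W x := by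
    intro x hx
    have hx0 : 0 < ‖x‖ := lt_trans (by positivity) hx.1
    have h1 : r ^ (-θ) ≤ ‖x‖ ^ (-θ) := Real.rpow_le_rpow_of_nonpos hx0 hx.2 (by linarith)
    have h2 : (1 + r) ^ b ≤ 2 ^ |b| * (1 + ‖x‖) ^ b := by
      rcases le_total 0 b with hb | hb
      · rw [abs_of_nonneg hb, ← Real.mul_rpow (by positivity) (by positivity)]
        exact Real.rpow_le_rpow (by positivity) (by linarith [hx.1]) hb
      · calc (1 + r) ^ b ≤ (1 + ‖x‖) ^ b :=
              Real.rpow_le_rpow_of_nonpos (by positivity) (by linarith [hx.2]) hb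
          _ ≤ _ := le_mul_of_one_le_left (by positivity)
              (Real.one_le_rpow (by norm_num) (abs_nonneg b))
    calc r ^ (-θ) * (1 + r) ^ b ≤ ‖x‖ ^ (-θ) * (2 ^ |b| * (1 + ‖x‖) ^ b) := by gcongr
      _ = _ := by simp only [hW]; ring
  have hWm : Measurable fun x => ENNReal.ofReal (W x) * rayTail G x := by
    have := measurable_rayTail hG
    fun_prop
  have step : ENNReal.ofReal (r ^ (-θ) * (1 + r) ^ b) * radialTail G r ≤
      ENNReal.ofReal (D * (r ^ N)⁻¹) * ∫⁻ x in S, ENNReal.ofReal (W x) * rayTail G x := by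
    calc ENNReal.ofReal (r ^ (-θ) * (1 + r) ^ b) * radialTail G r
        ≤ ENNReal.ofReal (r ^ (-θ) * (1 + r) ^ b) * (ENNReal.ofReal (2 ^ (N + 1) * (r ^ N)⁻¹) *
          ∫⁻ x in S, rayTail G x) := by
          gcongr
          exact radialTail_le_lintegral_rayTail hG hr
      _ = ENNReal.ofReal (2 ^ (N + 1) * (r ^ N)⁻¹) *
          ∫⁻ x in S, ENNReal.ofReal (r ^ (-θ) * (1 + r) ^ b) * rayTail G x := by
          rw [lintegral_const_mul' _ _ ENNReal.ofReal_ne_top]; ring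
      _ ≤ ENNReal.ofReal (2 ^ (N + 1) * (r ^ N)⁻¹) *
          ∫⁻ x in S, ENNReal.ofReal (2 ^ |b|) * (ENNReal.ofReal (W x) * rayTail G x) := by
          gcongr _ * ?_
          refine setLIntegral_mono' hSm fun x hx => ?_
          rw [← mul_assoc, ← ENNReal.ofReal_mul (by positivity)]
          gcongr ENNReal.ofReal ?_ * _
          exact hWle x hx
      _ = _ := by
          rw [lintegral_const_mul' _ _ ENNReal.ofReal_ne_top, ← mul_assoc,
            ← ENNReal.ofReal_mul (by positivity), hD]
          congr 2
          ring
  calc (ENNReal.ofReal (r ^ (N / P) * (r ^ (-θ) * (1 + r) ^ b)) * radialTail G r) ^ P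
      = (ENNReal.ofReal (r ^ (N / P)) *
        (ENNReal.ofReal (r ^ (-θ) * (1 + r) ^ b) * radialTail G r)) ^ P := by
        rw [ENNReal.ofReal_mul (by positivity), mul_assoc]
    _ ≤ (ENNReal.ofReal (r ^ (N / P)) * (ENNReal.ofReal (D * (r ^ N)⁻¹) *
        ∫⁻ x in S, ENNReal.ofReal (W x) * rayTail G x)) ^ P := by gcongr
    _ = ENNReal.ofReal ((r ^ (N / P) * (D * (r ^ N)⁻¹)) ^ P) *
        (∫⁻ x in S, ENNReal.ofReal (W x) * rayTail G x) ^ P := by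
        rw [← mul_assoc, ← ENNReal.ofReal_mul (by positivity),
          ENNReal.mul_rpow_of_nonneg _ _ hP0.le, ENNReal.ofReal_rpow_of_pos (by positivity)]
    _ ≤ ENNReal.ofReal ((r ^ (N / P) * (D * (r ^ N)⁻¹)) ^ P) *
        (ENNReal.ofReal ((r ^ N * ω) ^ (P - 1)) *
          ∫⁻ x, (ENNReal.ofReal (W x) * rayTail G x) ^ P) := by
        gcongr _ * ?_
        refine (rpow_lintegral_le hP hWm.aemeasurable).trans ?_
        rw [Measure.restrict_apply_univ]
        gcongr ?_ * ?_
        · rw [← ENNReal.ofReal_rpow_of_pos (by positivity)]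
          exact ENNReal.rpow_le_rpow hSvol (by linarith)
        · exact setLIntegral_le_lintegral _ _
    _ = _ := by
        rw [← mul_assoc, ← ENNReal.ofReal_mul (by positivity)]
        congr 2
        have e : (r ^ (N / P)) ^ P = r ^ N := by
          rw [← Real.rpow_mul hr.le, div_mul_cancel₀ _ hP0.ne', Real.rpow_natCast]
        rw [Real.mul_rpow (by positivity) (by positivity), e,
          Real.mul_rpow (by positivity) (by positivity), Real.inv_rpow (by positivity),
          Real.mul_rpow (by positivity : (0 : ℝ) ≤ r ^ N) hω0.le,
          Real.rpow_sub_one (by positivity : (r ^ N : ℝ) ≠ 0)]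
        field_simp

/-- The shell and Hardy estimates are applied to `G` truncated to `|y| > r`. Truncation leaves the
tail at `r` unchanged and restricts the energy to the exterior of the ball, which later yields the
limit at infinity. -/
theorem exists_radialTail_rpow_le (N : ℕ) {a θ P : ℝ} (hP : 1 ≤ P) (hθ0 : 0 ≤ θ) (hθ1 : θ ≤ 1)
    (hθ : θ < N / P) (ha : 1 < a + N / P) :
    ∃ C : ℝ, 0 < C ∧ ∀ G : RN N → ℝ≥0∞, Measurable G → ∀ r : ℝ, 0 < r →
      (ENNReal.ofReal (r ^ (N / P) * (r ^ (-θ) * (1 + r) ^ (a - 1 + θ))) * radialTail G r) ^ P ≤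
        ENNReal.ofReal C *
          ∫⁻ y in {y : RN N | r < ‖y‖}, (ENNReal.ofReal ((1 + ‖y‖) ^ a) * G y) ^ P := by
  obtain ⟨C₁, hC₁, h₁⟩ := exists_lintegral_rayTail_rpow_le N hP hθ1 hθ ha
  obtain ⟨C₂, hC₂, h₂⟩ := exists_radialTail_rpow_le_lintegral_rayTail N (b := a - 1 + θ) hP hθ0
  refine ⟨C₂ * C₁, by positivity, fun G hG r hr => ?_⟩
  have hm := hG.indicator (measurableSet_lt_norm r)
  have h := h₂ _ hm r hr
  rw [radialTail_indicator] at h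
  refine h.trans ?_
  rw [ENNReal.ofReal_mul hC₂.le, mul_assoc]
  gcongr _ * ?_
  refine (h₁ _ hm).trans_eq ?_
  rw [← lintegral_indicator (measurableSet_lt_norm r)]
  congr 1
  refine lintegral_congr fun y => ?_
  by_cases hy : y ∈ {y : RN N | r < ‖y‖}
  · simp only [Set.indicator_of_mem hy]
  · simp only [Set.indicator_of_notMem hy, mul_zero]
    exact ENNReal.zero_rpow_of_pos (by linarith)

theorem one_add_rpow_le_max_rpow {y : ℝ} (hy : 0 ≤ y) (β : ℝ) :
    (1 + y) ^ β ≤ 2 ^ |β| * (max 1 y) ^ β := by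
  have hm : 0 < max 1 y := lt_of_lt_of_le one_pos (le_max_left _ _)
  rcases le_total 0 β with hβ | hβ
  · rw [abs_of_nonneg hβ, ← Real.mul_rpow (by positivity) hm.le]
    exact Real.rpow_le_rpow (by positivity)
      (by linarith [le_max_left 1 y, le_max_right 1 y]) hβ
  · calc (1 + y) ^ β ≤ (max 1 y) ^ β :=
          Real.rpow_le_rpow_of_nonpos hm (max_le (by linarith) (by linarith)) hβ
      _ ≤ _ := le_mul_of_one_le_left (by positivity)
          (Real.one_le_rpow (by norm_num) (abs_nonneg β))

theorem integrableOn_rpow_mul_one_add_rpow {α β : ℝ} (hα : -1 < α) (hαβ : α + β < -1) :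
    IntegrableOn (fun y : ℝ => y ^ α * (1 + y) ^ β) (Set.Ioi 0) := by
  have hm : Measurable fun y : ℝ => y ^ α * (1 + y) ^ β := by fun_prop
  rw [← Set.Ioc_union_Ioi_eq_Ioi (zero_le_one' ℝ)]
  refine IntegrableOn.union ?_ ?_
  · have h : IntegrableOn (fun y : ℝ => 2 ^ |β| * y ^ α) (Set.Ioc 0 1) :=
      (intervalIntegral.intervalIntegrable_rpow' (a := 0) (b := 1) hα).1.const_mul _
    refine h.mono' hm.aestronglyMeasurable ?_
    filter_upwards [ae_restrict_mem measurableSet_Ioc] with y hy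
    have hy0 : 0 < y := hy.1
    rw [Real.norm_of_nonneg (by positivity), mul_comm]
    have := one_add_rpow_le_max_rpow hy0.le β
    rw [max_eq_left hy.2, Real.one_rpow, mul_one] at this
    gcongr
  · have h : IntegrableOn (fun y : ℝ => 2 ^ |β| * y ^ (α + β)) (Set.Ioi 1) :=
      (integrableOn_Ioi_rpow_of_lt hαβ one_pos).const_mul _
    refine h.mono' hm.aestronglyMeasurable ?_
    filter_upwards [ae_restrict_mem measurableSet_Ioi] with y hy
    have hy0 : 0 < y := lt_trans one_pos hy
    rw [Real.norm_of_nonneg (by positivity), Real.rpow_add hy0, mul_left_comm]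
    have := one_add_rpow_le_max_rpow hy0.le β
    rw [max_eq_right (le_of_lt hy)] at this
    gcongr

/-- Hölder with the kernel `|y|^(1-N) (1 + |y|)^(-a)`: its conjugate power is integrable at the
origin because `N < P`, and at infinity because `a + N/P > 1`. -/
theorem exists_radialTail_zero_rpow_le (N : ℕ) {a P : ℝ} (hP : 1 ≤ P) (hN : 1 ≤ N)
    (hNP : (N : ℝ) < P) (ha : 1 < a + N / P) :
    ∃ C : ℝ, 0 < C ∧ ∀ G : RN N → ℝ≥0∞, Measurable G →
      radialTail G 0 ^ P ≤
        ENNReal.ofReal C * ∫⁻ y, (ENNReal.ofReal ((1 + ‖y‖) ^ a) * G y) ^ P := by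
  have hN' : (1 : ℝ) ≤ N := by exact_mod_cast hN
  have hP1 : 1 < P := by linarith
  have hP0 : 0 < P := by linarith
  have hPs : 0 < P - 1 := by linarith
  set Q := Real.conjExponent P with hQ
  have hpq : P.HolderConjugate Q := Real.HolderConjugate.conjExponent hP1
  have hQ0 : 0 < Q := hpq.symm.pos
  have : Nonempty (Fin N) := ⟨⟨0, hN⟩⟩
  set k : RN N → ℝ := fun y => ‖y‖ ^ (1 - (N : ℝ)) * (1 + ‖y‖) ^ (-a) with hk
  have hkQ : ∀ y : RN N, (ENNReal.ofReal (k y)) ^ Q =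
      ENNReal.ofReal (‖y‖ ^ ((1 - (N : ℝ)) * Q) * (1 + ‖y‖) ^ (-a * Q)) := fun y => by
    rw [ENNReal.ofReal_rpow_of_nonneg (by positivity) hQ0.le,
      Real.mul_rpow (by positivity) (by positivity), ← Real.rpow_mul (by positivity),
      ← Real.rpow_mul (by positivity)]
  have hint : Integrable fun y : RN N => ‖y‖ ^ ((1 - (N : ℝ)) * Q) * (1 + ‖y‖) ^ (-a * Q) := by
    rw [integrable_fun_norm_addHaar volume
      (f := fun t : ℝ => t ^ ((1 - (N : ℝ)) * Q) * (1 + t) ^ (-a * Q)), finrank_euclideanSpace_fin]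
    have e1 : (N : ℝ) - 1 + (1 - (N : ℝ)) * Q = -((N - 1) / (P - 1)) := by
      rw [hQ, Real.conjExponent]; field_simp; ring
    have hlt : (N - 1) / (P - 1) < 1 := by rw [div_lt_one hPs]; linarith
    have e2 : (N : ℝ) - 1 + (1 - (N : ℝ)) * Q + -a * Q < -1 := by
      rw [e1, hQ, Real.conjExponent, ← mul_div_assoc, ← neg_div, ← add_div, div_lt_iff₀ hPs]
      have := mul_lt_mul_of_pos_right ha hP0
      rw [add_mul, div_mul_cancel₀ _ hP0.ne'] at this
      linarith
    refine (integrableOn_rpow_mul_one_add_rpow (by linarith) e2).congr_fun (fun t ht => ?_)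
      measurableSet_Ioi
    have ht0 : 0 < t := ht
    simp only [smul_eq_mul]
    rw [Real.rpow_add ht0, ← Nat.cast_pred hN, Real.rpow_natCast, mul_assoc]
  set I := ∫⁻ y, (ENNReal.ofReal (k y)) ^ Q with hI
  have hIfin : I ≠ ∞ := by
    have := hint.lintegral_lt_top
    rw [hI]
    simp only [hkQ]
    exact this.ne
  refine ⟨(I ^ (1 / Q)).toReal ^ P + 1, by positivity, fun G hG => ?_⟩
  set H : RN N → ℝ≥0∞ := fun y => ENNReal.ofReal ((1 + ‖y‖) ^ a) * G y with hH
  have hbase : radialTail G 0 ≤ ∫⁻ y, ENNReal.ofReal (k y) * H y := by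
    refine (setLIntegral_le_lintegral _ _).trans_eq (lintegral_congr fun y => ?_)
    simp only [hk, hH]
    rw [← mul_assoc, ← ENNReal.ofReal_mul (by positivity), mul_assoc (_ ^ _),
      ← Real.rpow_add (by positivity), neg_add_cancel, Real.rpow_zero, mul_one]
  calc radialTail G 0 ^ P ≤ (I ^ (1 / Q) * (∫⁻ y, H y ^ P) ^ (1 / P)) ^ P := by
        gcongr
        refine hbase.trans ?_
        exact ENNReal.lintegral_mul_le_Lp_mul_Lq volume hpq.symm (by fun_prop) (by fun_prop)
    _ = (I ^ (1 / Q)) ^ P * ∫⁻ y, H y ^ P := by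
        rw [ENNReal.mul_rpow_of_nonneg _ _ hP0.le, ← ENNReal.rpow_mul _ (1 / P),
          one_div_mul_cancel hP0.ne', ENNReal.rpow_one]
    _ ≤ _ := by
        gcongr
        have hI' : I ^ (1 / Q) ≠ ∞ := ENNReal.rpow_ne_top_of_nonneg (by positivity) hIfin
        rw [← ENNReal.ofReal_toReal hI', ENNReal.ofReal_rpow_of_nonneg (by positivity) hP0.le,
          ENNReal.toReal_ofReal (by positivity)]
        exact ENNReal.ofReal_le_ofReal (by linarith)

end RadialTail

/-! ### Smoothness of superpositions of dilates and translates -/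

section ParametricIntegral

variable {Q E F : Type} [MeasurableSpace Q] {μ : Measure Q}
  [NormedAddCommGroup E] [NormedSpace ℝ E] [MeasurableSpace E] [BorelSpace E]
  [SecondCountableTopology E] [NormedAddCommGroup F] [NormedSpace ℝ F]

theorem integrable_smul_comp_affine {h α : Q → ℝ} {β : Q → E} {φ : E → F}
    (hh : Integrable h μ) (hα : Measurable α) (hβ : Measurable β)
    (hφ : Continuous φ) (hc : HasCompactSupport φ) (x : E) :
    Integrable (fun p => h p • φ (α p • x + β p)) μ := by
  obtain ⟨M, hM⟩ := hc.exists_bound_of_continuous hφ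
  refine (hh.norm.mul_const M).mono' (hh.aestronglyMeasurable.smul
    (hφ.comp_aestronglyMeasurable ((hα.smul_const x).add hβ).aestronglyMeasurable))
    (Eventually.of_forall fun p => ?_)
  rw [norm_smul]
  exact mul_le_mul_of_nonneg_left (hM _) (norm_nonneg _)

theorem hasFDerivAt_integral_smul_comp_affine {h α : Q → ℝ} {β : Q → E} {φ : E → F}
    (hh : Integrable h μ) (hα : Measurable α) (hβ : Measurable β)
    (hhα : Integrable (fun p => h p * α p) μ)
    (hφ : ContDiff ℝ 1 φ) (hc : HasCompactSupport φ) (x : E) :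
    HasFDerivAt (fun x => ∫ p, h p • φ (α p • x + β p) ∂μ)
      (∫ p, (h p * α p) • fderiv ℝ φ (α p • x + β p) ∂μ) x := by
  have hcont : Continuous (fderiv ℝ φ) := hφ.continuous_fderiv one_ne_zero
  obtain ⟨M, hM⟩ := (hc.fderiv (𝕜 := ℝ)).exists_bound_of_continuous hcont
  refine hasFDerivAt_integral_of_dominated_of_fderiv_le (s := Set.univ)
    (F' := fun x p => (h p * α p) • fderiv ℝ φ (α p • x + β p))
    (bound := fun p => ‖h p * α p‖ * M) univ_mem
    (Eventually.of_forall fun y =>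
      (integrable_smul_comp_affine hh hα hβ hφ.continuous hc y).aestronglyMeasurable)
    (integrable_smul_comp_affine hh hα hβ hφ.continuous hc x)
    (integrable_smul_comp_affine hhα hα hβ hcont (hc.fderiv (𝕜 := ℝ)) x).aestronglyMeasurable
    (Eventually.of_forall fun p y _ => ?_) (hhα.norm.mul_const M)
    (Eventually.of_forall fun p y _ => ?_)
  · rw [norm_smul]
    exact mul_le_mul_of_nonneg_left (hM _) (norm_nonneg _)
  · have h1 : HasFDerivAt (fun y => α p • y + β p) (α p • ContinuousLinearMap.id ℝ E) y :=
      ((hasFDerivAt_id y).const_smul (α p)).add_const _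
    have h2 := ((hφ.differentiable one_ne_zero _).hasFDerivAt.comp y h1).const_smul (h p)
    refine h2.congr_fderiv ?_
    ext z
    simp [mul_smul]

/-- Each derivative in `x` brings out a factor `α`, hence the hypothesis on all moments `h α^k`. The
target space varies in the induction because the derivative takes values in linear maps. -/
theorem contDiff_integral_smul_comp_affine {α : Q → ℝ} {β : Q → E}
    (hα : Measurable α) (hβ : Measurable β) (n : ℕ) :
    ∀ {F : Type} [NormedAddCommGroup F] [NormedSpace ℝ F] {h : Q → ℝ} {φ : E → F},
    (∀ k : ℕ, Integrable (fun p => h p * α p ^ k) μ) →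
    ContDiff ℝ n φ → HasCompactSupport φ →
    ContDiff ℝ n (fun x => ∫ p, h p • φ (α p • x + β p) ∂μ) := by
  induction n with
  | zero =>
    intro F _ _ h φ hh hφ hc
    have h0 : Integrable h μ := by simpa using hh 0
    have hφc : Continuous φ := hφ.continuous
    obtain ⟨M, hM⟩ := hc.exists_bound_of_continuous hφc
    rw [Nat.cast_zero, contDiff_zero]
    refine continuous_of_dominated (bound := fun p => ‖h p‖ * M)
      (fun y => (integrable_smul_comp_affine h0 hα hβ hφc hc y).aestronglyMeasurable)
      (fun y => Eventually.of_forall fun p => ?_) (h0.norm.mul_const M)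
      (Eventually.of_forall fun p => ?_)
    · rw [norm_smul]
      exact mul_le_mul_of_nonneg_left (hM _) (norm_nonneg _)
    · fun_prop
  | succ n ih =>
    intro F _ _ h φ hh hφ hc
    have h0 : Integrable h μ := by simpa using hh 0
    have h1 : Integrable (fun p => h p * α p) μ := by simpa using hh 1
    have hφ1 : ContDiff ℝ 1 φ := hφ.of_le (by norm_cast; omega)
    have hd := hasFDerivAt_integral_smul_comp_affine h0 hα hβ h1 hφ1 hc
    rw [Nat.cast_succ, contDiff_succ_iff_fderiv]
    refine ⟨fun x => (hd x).differentiableAt, by simp, ?_⟩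
    rw [show fderiv ℝ (fun x => ∫ p, h p • φ (α p • x + β p) ∂μ) =
      fun x => ∫ p, (h p * α p) • fderiv ℝ φ (α p • x + β p) ∂μ from
      funext fun x => (hd x).fderiv]
    refine ih (fun k => ?_) (hφ.fderiv_right (by norm_cast)) (hc.fderiv (𝕜 := ℝ))
    simpa only [mul_assoc, ← pow_succ'] using hh (k + 1)

end ParametricIntegral

/-! ### A test function minus its dilation as a divergence -/

section Divergence

variable {N : ℕ}

/-- The test function `y ↦ T^(-N) φ(y/T)`, for `T ≠ 0`. -/
noncomputable def dilate (T : ℝ) (hT : T ≠ 0) (φ : 𝓓((⊤ : Opens (RN N)), ℝ)) :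
    𝓓((⊤ : Opens (RN N)), ℝ) where
  toFun y := (T ^ N)⁻¹ * φ (T⁻¹ • y)
  contDiff' := contDiff_const.mul (φ.contDiff.comp (contDiff_const_smul _))
  hasCompactSupport' := (φ.hasCompactSupport.comp_homeomorph
    (Homeomorph.smulOfNeZero _ (inv_ne_zero hT))).mul_left
  tsupport_subset' := by simp

theorem dilate_apply {T : ℝ} (hT : T ≠ 0) (φ : 𝓓((⊤ : Opens (RN N)), ℝ)) (y : RN N) :
    dilate T hT φ y = (T ^ N)⁻¹ * φ (T⁻¹ • y) := rfl

theorem testFunction_hasFDerivAt (φ : 𝓓((⊤ : Opens (RN N)), ℝ)) (x : RN N) :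
    HasFDerivAt φ (fderiv ℝ φ x) x :=
  (φ.contDiff.differentiable (by simp) x).hasFDerivAt

theorem lineDeriv_testFunction (φ : 𝓓((⊤ : Opens (RN N)), ℝ)) (v x : RN N) :
    (∂_{v} φ) x = fderiv ℝ φ x v := by
  rw [TestFunction.lineDerivOp_eq_lineDerivCLM ℝ, TestFunction.lineDerivCLM_apply_of_le (by simp)]
  exact (testFunction_hasFDerivAt φ x).differentiableAt.lineDeriv_eq_fderiv

theorem exists_norm_le_of_ne_zero (φ : 𝓓((⊤ : Opens (RN N)), ℝ)) :
    ∃ R : ℝ, 0 < R ∧ ∀ x, φ x ≠ 0 → ‖x‖ ≤ R := by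
  obtain ⟨R, hR⟩ := φ.hasCompactSupport.isBounded.exists_norm_le
  refine ⟨max R 1, by positivity, fun x hx => (hR x (subset_tsupport _ hx)).trans (le_max_left _ _)⟩

theorem sum_smul_single (y : RN N) : ∑ i, y i • (EuclideanSpace.single i (1 : ℝ) : RN N) = y := by
  simpa using (EuclideanSpace.basisFun (Fin N) ℝ).sum_repr y

theorem sum_coord_mul_clm (L : RN N →L[ℝ] ℝ) (y : RN N) :
    ∑ i, y i * L (EuclideanSpace.single i (1 : ℝ)) = L y := by
  conv_rhs => rw [← sum_smul_single y]
  simp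

/-- The fundamental theorem of calculus for `t ↦ t^(-N) φ(y/t)` on `[1, T]`. -/
theorem integral_dilation_deriv (φ : 𝓓((⊤ : Opens (RN N)), ℝ)) {T : ℝ} (hT : 1 ≤ T) (y : RN N) :
    (N : ℝ) * (∫ t in Set.Ioc 1 T, (t ^ (N + 1))⁻¹ * φ (t⁻¹ • y)) +
      ∫ t in Set.Ioc 1 T, ((t ^ (N + 1))⁻¹ * t⁻¹) * fderiv ℝ φ (t⁻¹ • y) y =
    φ y - (T ^ N)⁻¹ * φ (T⁻¹ • y) := by
  have hne : ∀ t ∈ Set.Icc 1 T, t ≠ 0 := fun t ht => (lt_of_lt_of_le one_pos ht.1).ne'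
  have hinv : ContinuousOn (fun t : ℝ => t⁻¹) (Set.Icc 1 T) := continuousOn_id.inv₀ hne
  have hpow : ContinuousOn (fun t : ℝ => (t ^ (N + 1))⁻¹) (Set.Icc 1 T) :=
    ContinuousOn.inv₀ (by fun_prop) fun t ht => pow_ne_zero _ (hne t ht)
  have hφ' : Continuous (fderiv ℝ φ) := φ.contDiff.continuous_fderiv (by simp)
  have hsm : ContinuousOn (fun t : ℝ => t⁻¹ • y) (Set.Icc 1 T) := hinv.smul continuousOn_const
  have c1 : ContinuousOn (fun t : ℝ => (t ^ (N + 1))⁻¹ * φ (t⁻¹ • y)) (Set.Icc 1 T) :=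
    hpow.mul (φ.continuous.comp_continuousOn hsm)
  have c2 : ContinuousOn (fun t : ℝ => ((t ^ (N + 1))⁻¹ * t⁻¹) * fderiv ℝ φ (t⁻¹ • y) y)
      (Set.Icc 1 T) :=
    (hpow.mul hinv).mul ((hφ'.comp_continuousOn hsm).clm_apply continuousOn_const)
  have hftc := intervalIntegral.integral_eq_sub_of_hasDerivAt (a := 1) (b := T)
    (f := fun t : ℝ => (t ^ N)⁻¹ * φ (t⁻¹ • y))
    (f' := fun t => -((N : ℝ) * ((t ^ (N + 1))⁻¹ * φ (t⁻¹ • y)) +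
      ((t ^ (N + 1))⁻¹ * t⁻¹) * fderiv ℝ φ (t⁻¹ • y) y)) ?_ ?_
  · rw [intervalIntegral.integral_of_le hT, integral_neg, integral_add, integral_const_mul] at hftc
    · simp only [one_pow, inv_one, one_mul, one_smul] at hftc
      linarith
    · exact (c1.integrableOn_Icc.mono_set Set.Ioc_subset_Icc_self).const_mul _
    · exact c2.integrableOn_Icc.mono_set Set.Ioc_subset_Icc_self
  · intro t ht
    rw [Set.uIcc_of_le hT] at ht
    have ht0 : 0 < t := lt_of_lt_of_le one_pos ht.1
    have d1 : HasDerivAt (fun t : ℝ => (t ^ N)⁻¹) (-((N : ℝ) * (t ^ (N + 1))⁻¹)) t := by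
      have := (hasDerivAt_zpow (-(N : ℤ)) t (Or.inl ht0.ne'))
      simp only [zpow_neg, zpow_natCast] at this
      refine this.congr_deriv ?_
      rw [Int.cast_neg, Int.cast_natCast, neg_mul,
        show (-(N : ℤ) - 1) = -((N + 1 : ℕ) : ℤ) by push_cast; ring, zpow_neg, zpow_natCast]
    have d2 : HasDerivAt (fun t : ℝ => t⁻¹ • y) ((-(t ^ 2)⁻¹) • y) t :=
      (hasDerivAt_inv ht0.ne').smul_const y
    have d3 := (testFunction_hasFDerivAt φ (t⁻¹ • y)).comp_hasDerivAt t d2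
    refine (d1.mul d3).congr_deriv ?_
    rw [map_smul, smul_eq_mul, Function.comp_apply]
    field_simp
    ring
  · apply ContinuousOn.intervalIntegrable
    rw [Set.uIcc_of_le hT]
    exact ((continuousOn_const.mul c1).add c2).neg

/-- The function `φ` minus its dilation is the divergence of the vector field
`y ∫_1^T t^(-N-1) φ(y/t) dt`. -/
theorem exists_divergence_eq_sub_dilate (φ : 𝓓((⊤ : Opens (RN N)), ℝ)) {T : ℝ} (hT : 1 ≤ T) :
    ∃ Ψ : Fin N → 𝓓((⊤ : Opens (RN N)), ℝ),
      (∀ i y, Ψ i y = y i * ∫ t in Set.Ioc 1 T, (t ^ (N + 1))⁻¹ * φ (t⁻¹ • y)) ∧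
      ∑ i, ∂_{(EuclideanSpace.single i (1 : ℝ) : RN N)} (Ψ i) = φ - dilate T (by positivity) φ := by
  set μ : Measure ℝ := volume.restrict (Set.Ioc 1 T) with hμ
  have hint : ∀ k : ℕ, Integrable (fun t : ℝ => (t ^ (N + 1))⁻¹ * t⁻¹ ^ k) μ := fun k => by
    refine (ContinuousOn.integrableOn_Icc ?_).mono_set Set.Ioc_subset_Icc_self
    refine ContinuousOn.mul (ContinuousOn.inv₀ (by fun_prop) ?_)
      ((ContinuousOn.inv₀ continuousOn_id ?_).pow k) <;>
    · intro t ht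
      have : 0 < t := lt_of_lt_of_le one_pos ht.1
      positivity
  have h0 : Integrable (fun t : ℝ => (t ^ (N + 1))⁻¹) μ := by simpa using hint 0
  have h1 : Integrable (fun t : ℝ => (t ^ (N + 1))⁻¹ * t⁻¹) μ := by simpa using hint 1
  -- The `+ 0` puts the integrand in the affine form of the parametric lemmas. The field is `y
  -- F(y)`, with divergence `N F + DF(y) y`, the left side of `integral_dilation_deriv`.
  set F : RN N → ℝ := fun y => ∫ t, (t ^ (N + 1))⁻¹ • φ (t⁻¹ • y + 0) ∂μ with hF
  have hFd : ContDiff ℝ ((⊤ : ℕ∞) : WithTop ℕ∞) F := contDiff_infty.2 fun n =>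
    contDiff_integral_smul_comp_affine (by fun_prop) measurable_const n hint
      (φ.contDiff.of_le (mod_cast le_top)) φ.hasCompactSupport
  have hF' := hasFDerivAt_integral_smul_comp_affine h0 measurable_inv (measurable_const (a := 0)) h1
      (φ.contDiff.of_le (mod_cast le_top)) φ.hasCompactSupport
  obtain ⟨R, hR, hφR⟩ := exists_norm_le_of_ne_zero φ
  have hFsupp : ∀ y, T * R < ‖y‖ → F y = 0 := by
    intro y hy
    refine setIntegral_eq_zero_of_forall_eq_zero fun t ht => ?_
    have ht0 : 0 < t := one_pos.trans ht.1
    by_contra hne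
    have h2 : φ (t⁻¹ • y) ≠ 0 := fun h => hne (by simp [h])
    have h3 := hφR _ h2
    rw [norm_smul, Real.norm_of_nonneg (by positivity), inv_mul_le_iff₀ ht0] at h3
    have : t * R ≤ T * R := by gcongr; exact ht.2
    linarith
  let Ψ : Fin N → 𝓓((⊤ : Opens (RN N)), ℝ) := fun i =>
    { toFun := fun y => y i * F y
      contDiff' := ContDiff.mul (by fun_prop) hFd
      hasCompactSupport' := HasCompactSupport.intro (isCompact_closedBall (0 : RN N) (T * R))
        fun y hy => by rw [hFsupp y (by simpa using hy), mul_zero]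
      tsupport_subset' := by simp }
  have hΨ : ∀ i y, Ψ i y = y i * F y := fun _ _ => rfl
  refine ⟨Ψ, fun i y => by rw [hΨ, hF]; simp [hμ], ?_⟩
  ext y
  have hsum : (∑ i, ∂_{(EuclideanSpace.single i (1 : ℝ) : RN N)} (Ψ i)) y =
      ∑ i, (∂_{(EuclideanSpace.single i (1 : ℝ) : RN N)} (Ψ i)) y := by
    simp
  set F' := ∫ t, ((t ^ (N + 1))⁻¹ * t⁻¹) • fderiv ℝ φ (t⁻¹ • y + 0) ∂μ with hF'def
  have hder : ∀ i, (∂_{(EuclideanSpace.single i (1 : ℝ) : RN N)} (Ψ i)) y =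
      F y + y i * F' (EuclideanSpace.single i (1 : ℝ)) := by
    intro i
    rw [lineDeriv_testFunction]
    have hp : HasFDerivAt (fun z : RN N => z i) (EuclideanSpace.proj i : RN N →L[ℝ] ℝ) y :=
      (EuclideanSpace.proj i : RN N →L[ℝ] ℝ).hasFDerivAt
    have hm : HasFDerivAt (Ψ i) (y i • F' + F y • (EuclideanSpace.proj i : RN N →L[ℝ] ℝ)) y :=
      hp.mul (hF' y)
    rw [hm.fderiv]
    have h2 : (EuclideanSpace.proj i : RN N →L[ℝ] ℝ) (EuclideanSpace.single i 1) = 1 := by simp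
    rw [add_apply, smul_apply,
      smul_apply, h2, smul_eq_mul, smul_eq_mul, mul_one, add_comm]
  rw [hsum, Finset.sum_congr rfl fun i _ => hder i, Finset.sum_add_distrib, sum_coord_mul_clm]
  have hF'y : F' y = ∫ t, ((t ^ (N + 1))⁻¹ * t⁻¹) * fderiv ℝ φ (t⁻¹ • y) y ∂μ := by
    rw [hF'def, ContinuousLinearMap.integral_apply (integrable_smul_comp_affine h1 measurable_inv
      measurable_const (φ.contDiff.continuous_fderiv (by simp))
      (φ.hasCompactSupport.fderiv (𝕜 := ℝ)) y)]
    simp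
  have hFy : F y = ∫ t in Set.Ioc 1 T, (t ^ (N + 1))⁻¹ * φ (t⁻¹ • y) := by simp [hF, hμ]
  rw [hF'y, hFy, hμ]
  simp only [Finset.sum_const, Finset.card_univ, Fintype.card_fin, nsmul_eq_mul]
  exact integral_dilation_deriv φ hT y

end Divergence

/-! ### Mean-zero test functions as divergences -/

section MeanZero

variable {N : ℕ}

theorem integrable_testFunction (φ : 𝓓((⊤ : Opens (RN N)), ℝ)) : Integrable φ :=
  φ.continuous.integrable_of_hasCompactSupport φ.hasCompactSupport

theorem integral_fderiv_segment (φ : 𝓓((⊤ : Opens (RN N)), ℝ)) (x a : RN N) :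
    ∫ τ in Set.Ioc (0 : ℝ) 1, fderiv ℝ φ (x - τ • a) a = φ x - φ (x - a) := by
  have hφ' : Continuous (fderiv ℝ φ) := φ.contDiff.continuous_fderiv (by simp)
  have h := intervalIntegral.integral_eq_sub_of_hasDerivAt (a := 0) (b := 1)
    (f := fun τ : ℝ => -φ (x - τ • a)) (f' := fun τ => fderiv ℝ φ (x - τ • a) a) ?_ ?_
  · rw [intervalIntegral.integral_of_le zero_le_one] at h
    simp only [one_smul, zero_smul, sub_zero] at h
    rw [h]; ring
  · intro τ _
    have d1 : HasDerivAt (fun τ : ℝ => x - τ • a) (-a) τ := by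
      simpa using ((hasDerivAt_id τ).smul_const a).const_sub x
    refine ((testFunction_hasFDerivAt φ (x - τ • a)).comp_hasDerivAt τ d1).neg.congr_deriv ?_
    simp
  · exact Continuous.intervalIntegrable (by fun_prop) _ _

/-- The difference of `φ` (times the mass of `η`) and of the convolution of `φ` with `η` is a
divergence. -/
theorem exists_divergence_eq_sub_convolution (φ η : 𝓓((⊤ : Opens (RN N)), ℝ)) :
    ∃ Ψ : Fin N → 𝓓((⊤ : Opens (RN N)), ℝ), ∀ x,
      (∑ i, ∂_{(EuclideanSpace.single i (1 : ℝ) : RN N)} (Ψ i)) x =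
        (∫ a, η a) * φ x - ∫ a, η a * φ (x - a) := by
  set μ : Measure (RN N × ℝ) := (volume : Measure (RN N)).prod (volume.restrict (Set.Ioc 0 1))
    with hμ
  have hη := η.continuous
  have hh : ∀ i, Integrable (fun p : RN N × ℝ => p.1 i * η p.1) μ := fun i => by
    have h1 : Integrable fun a : RN N => a i * η a :=
      Continuous.integrable_of_hasCompactSupport (by fun_prop) η.hasCompactSupport.mul_left
    simpa using h1.mul_prod (integrable_const (1 : ℝ))
  have hβ : Measurable fun p : RN N × ℝ => -(p.2 • p.1) := by fun_prop
  -- The field is `∫ η(a) a ∫_0^1 φ(x - τ a) dτ da`: its divergence integrates the derivative of `φ`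
  -- along the segment from `x - a` to `x`.
  set F : Fin N → RN N → ℝ := fun i x =>
    ∫ p : RN N × ℝ, (p.1 i * η p.1) • φ ((1 : ℝ) • x + -(p.2 • p.1)) ∂μ with hF
  have hFd : ∀ i, ContDiff ℝ ((⊤ : ℕ∞) : WithTop ℕ∞) (F i) := fun i => contDiff_infty.2 fun n =>
    contDiff_integral_smul_comp_affine measurable_const hβ n (fun k => by simpa using hh i)
      (φ.contDiff.of_le (mod_cast le_top)) φ.hasCompactSupport
  have hφ' : Continuous (fderiv ℝ φ) := φ.contDiff.continuous_fderiv (by simp)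
  have hFint : ∀ i x, Integrable (fun p : RN N × ℝ => (p.1 i * η p.1 * 1) •
      fderiv ℝ φ ((1 : ℝ) • x + -(p.2 • p.1))) μ := fun i x =>
    integrable_smul_comp_affine (by simpa using hh i) measurable_const hβ hφ'
      (φ.hasCompactSupport.fderiv (𝕜 := ℝ)) x
  have hF' : ∀ i x, HasFDerivAt (F i) (∫ p : RN N × ℝ, (p.1 i * η p.1 * 1) •
      fderiv ℝ φ ((1 : ℝ) • x + -(p.2 • p.1)) ∂μ) x := fun i x =>
    hasFDerivAt_integral_smul_comp_affine (hh i) measurable_const hβ (by simpa using hh i)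
      (φ.contDiff.of_le (mod_cast le_top)) φ.hasCompactSupport x
  obtain ⟨R, hR, hφR⟩ := exists_norm_le_of_ne_zero φ
  obtain ⟨S, hS, hηS⟩ := exists_norm_le_of_ne_zero η
  have hFsupp : ∀ i x, R + S < ‖x‖ → F i x = 0 := by
    intro i x hx
    simp only [hF]
    have hz : ∀ᵐ p : RN N × ℝ ∂μ,
        (p.1 i * η p.1) • φ ((1 : ℝ) • x + -(p.2 • p.1)) = 0 := by
      have h2 : ∀ᵐ p : RN N × ℝ ∂μ, p.2 ∈ Set.Ioc (0 : ℝ) 1 :=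
        Measure.quasiMeasurePreserving_snd.ae (ae_restrict_mem measurableSet_Ioc)
      filter_upwards [h2] with p hp
      by_contra hne
      have h3 : η p.1 ≠ 0 := fun h => hne (by simp [h])
      have h4 : φ ((1 : ℝ) • x + -(p.2 • p.1)) ≠ 0 := fun h => hne (by rw [h, smul_zero])
      have h5 := hηS _ h3
      have h6 := hφR _ h4
      rw [one_smul, ← sub_eq_add_neg] at h6
      have h7 : ‖p.2 • p.1‖ ≤ S := by
        rw [norm_smul, Real.norm_of_nonneg hp.1.le]
        exact (mul_le_of_le_one_left (norm_nonneg _) hp.2).trans h5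
      have h8 := norm_le_norm_sub_add x (p.2 • p.1)
      linarith
    rw [integral_congr_ae hz, integral_zero]
  let Ψ : Fin N → 𝓓((⊤ : Opens (RN N)), ℝ) := fun i =>
    { toFun := F i
      contDiff' := hFd i
      hasCompactSupport' := HasCompactSupport.intro (isCompact_closedBall (0 : RN N) (R + S))
        fun y hy => hFsupp i y (by simpa using hy)
      tsupport_subset' := by simp }
  refine ⟨Ψ, fun x => ?_⟩
  have hsum : (∑ i, ∂_{(EuclideanSpace.single i (1 : ℝ) : RN N)} (Ψ i)) x =
      ∑ i, (∂_{(EuclideanSpace.single i (1 : ℝ) : RN N)} (Ψ i)) x := by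
    simp
  have hder : ∀ i, (∂_{(EuclideanSpace.single i (1 : ℝ) : RN N)} (Ψ i)) x =
      ∫ p : RN N × ℝ,
        η p.1 * (p.1 i * fderiv ℝ φ (x - p.2 • p.1) (EuclideanSpace.single i 1)) ∂μ := by
    intro i
    rw [lineDeriv_testFunction, show (Ψ i : RN N → ℝ) = F i from rfl, (hF' i x).fderiv,
      ContinuousLinearMap.integral_apply (hFint i x)]
    refine integral_congr_ae (Eventually.of_forall fun p => ?_)
    simp only [mul_one, one_smul, ← sub_eq_add_neg, smul_apply, smul_eq_mul]
    ring
  have hint : ∀ i, Integrable (fun p : RN N × ℝ =>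
      η p.1 * (p.1 i * fderiv ℝ φ (x - p.2 • p.1) (EuclideanSpace.single i 1))) μ := fun i => by
    refine ((hFint i x).apply_continuousLinearMap (EuclideanSpace.single i 1)).congr
      (Eventually.of_forall fun p => ?_)
    simp only [mul_one, one_smul, ← sub_eq_add_neg, smul_apply, smul_eq_mul]
    ring
  have hsum2 : ∀ p : RN N × ℝ,
      ∑ i, η p.1 * (p.1 i * fderiv ℝ φ (x - p.2 • p.1) (EuclideanSpace.single i 1)) =
        η p.1 * fderiv ℝ φ (x - p.2 • p.1) p.1 := fun p => by
    rw [← Finset.mul_sum, sum_coord_mul_clm]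
  have hint2 : Integrable (fun p : RN N × ℝ => η p.1 * fderiv ℝ φ (x - p.2 • p.1) p.1) μ := by
    have := integrable_finsetSum Finset.univ fun i _ => hint i
    simpa only [hsum2] using this
  rw [hsum, Finset.sum_congr rfl fun i _ => hder i, ← integral_finsetSum _ fun i _ => hint i]
  simp only [hsum2]
  rw [integral_prod _ hint2]
  simp only [integral_const_mul, integral_fderiv_segment]
  simp only [mul_sub]
  rw [integral_sub ((integrable_testFunction η).mul_const _), integral_mul_const]
  exact ((φ.continuous.comp (continuous_const.sub continuous_id)).mul hη |>.congr
    fun a => mul_comm _ _).integrable_of_hasCompactSupport η.hasCompactSupport.mul_right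

/-- A test function with vanishing integral is a divergence. -/
theorem exists_divergence_of_integral (φ η : 𝓓((⊤ : Opens (RN N)), ℝ)) :
    ∃ Ψ : Fin N → 𝓓((⊤ : Opens (RN N)), ℝ),
      ∑ i, ∂_{(EuclideanSpace.single i (1 : ℝ) : RN N)} (Ψ i) = (∫ a, η a) • φ - (∫ a, φ a) • η := by
  obtain ⟨Ψ₁, h₁⟩ := exists_divergence_eq_sub_convolution φ η
  obtain ⟨Ψ₂, h₂⟩ := exists_divergence_eq_sub_convolution η φ
  refine ⟨fun i => Ψ₁ i - Ψ₂ i, ?_⟩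
  simp only [TestFunction.lineDerivOp_eq_lineDerivCLM ℝ, map_sub, Finset.sum_sub_distrib]
  ext x
  -- The two convolution terms cancel because convolution is commutative.
  have e : ∫ a, η a * φ (x - a) = ∫ a, φ a * η (x - a) := by
    rw [← integral_sub_left_eq_self _ volume x]
    simp only [sub_sub_cancel]
    simp only [mul_comm]
  have h₁' := h₁ x
  have h₂' := h₂ x
  change (∑ i, ∂_{(EuclideanSpace.single i (1 : ℝ) : RN N)} (Ψ₁ i)) x -
    (∑ i, ∂_{(EuclideanSpace.single i (1 : ℝ) : RN N)} (Ψ₂ i)) x =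
    (∫ a, η a) * φ x - (∫ a, φ a) * η x
  rw [h₁', h₂', e]
  ring

theorem exists_testFunction_integral_eq_one :
    ∃ η : 𝓓((⊤ : Opens (RN N)), ℝ), ∫ a, η a = 1 := by
  let f : ContDiffBump (0 : RN N) := default
  exact ⟨⟨f.normed volume, f.contDiff_normed, f.hasCompactSupport_normed, by simp⟩,
    f.integral_normed⟩

theorem dilate_lineDeriv {T : ℝ} (hT : T ≠ 0) (ψ : 𝓓((⊤ : Opens (RN N)), ℝ)) (v : RN N) :
    dilate T hT (∂_{v} ψ) = T • ∂_{v} (dilate T hT ψ) := by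
  ext x
  change (T ^ N)⁻¹ * (∂_{v} ψ) (T⁻¹ • x) = T * (∂_{v} (dilate T hT ψ)) x
  rw [lineDeriv_testFunction, lineDeriv_testFunction]
  have h1 : HasFDerivAt (fun x : RN N => T⁻¹ • x) (T⁻¹ • ContinuousLinearMap.id ℝ (RN N)) x :=
    (hasFDerivAt_id x).const_smul T⁻¹
  have h2 : HasFDerivAt (dilate T hT ψ) _ x :=
    ((testFunction_hasFDerivAt ψ (T⁻¹ • x)).comp x h1).const_mul ((T ^ N)⁻¹)
  rw [h2.fderiv]
  simp
  field_simp

end MeanZero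

/-! ### The ray primitive and its identification with `u` up to a constant -/

section RayPrimitive

variable {N : ℕ}

theorem distrOfFun_apply {f : RN N → ℝ} (hf : LocallyIntegrable f volume)
    (φ : 𝓓((⊤ : Opens (RN N)), ℝ)) : distrOfFun f φ = ∫ x, φ x * f x :=
  TestFunction.integralAgainstBilinCLM_eq_integral (Ω := (⊤ : Opens (RN N)))
    (by simpa using hf.locallyIntegrableOn Set.univ)

theorem constDistr_apply (c : ℝ) (φ : 𝓓((⊤ : Opens (RN N)), ℝ)) :
    constDistr N c φ = (∫ x, φ x) * c := by
  rw [constDistr, distrOfFun_apply (locallyIntegrable_const c), integral_mul_const]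

theorem integrable_testFunction_mul {f : RN N → ℝ} (hf : LocallyIntegrable f volume)
    (φ : 𝓓((⊤ : Opens (RN N)), ℝ)) : Integrable fun x => φ x * f x := by
  simpa using hf.integrable_smul_left_of_hasCompactSupport φ.continuous φ.hasCompactSupport

theorem GradRepresents.locallyIntegrable {u : Distr N} {g : RN N → RN N}
    (hg : GradRepresents u g) : LocallyIntegrable g volume := by
  have h : g = ∑ i, fun y => g y i • (EuclideanSpace.single i (1 : ℝ) : RN N) := by
    ext1 y
    rw [Finset.sum_apply]
    exact (sum_smul_single (g y)).symm
  rw [h]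
  refine locallyIntegrable_finsetSum' _ fun i _ => ?_
  intro x
  obtain ⟨K, hK, hi⟩ := (hg i).1 x
  exact ⟨K, hK, Integrable.smul_const hi _⟩

theorem GradRepresents.apply_lineDeriv {u : Distr N} {g : RN N → RN N}
    (hg : GradRepresents u g) (i : Fin N) (ψ : 𝓓((⊤ : Opens (RN N)), ℝ)) :
    u (∂_{(EuclideanSpace.single i (1 : ℝ) : RN N)} ψ) = -∫ x, ψ x * g x i := by
  have h := Distribution.lineDerivOp_apply_apply u ψ (EuclideanSpace.single i (1 : ℝ))
  rw [(hg i).2, distrOfFun_apply (hg i).1, map_neg] at h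
  rw [h, neg_neg]

theorem enorm_real_inner_le (x y : RN N) : ‖(inner ℝ x y : ℝ)‖ₑ ≤ ‖x‖ₑ * ‖y‖ₑ := by
  rw [← ofReal_norm, ← ofReal_norm x, ← ofReal_norm y, ← ENNReal.ofReal_mul (norm_nonneg _)]
  exact ENNReal.ofReal_le_ofReal (norm_inner_le_norm x y)

/-- The function `x ↦ -∫_1^∞ x · g(t x) dt`, which is the primitive of the gradient field `g` that
vanishes at infinity along the half-lines issuing from the origin. -/
noncomputable def rayPrimitive (g : RN N → RN N) (x : RN N) : ℝ :=
  -∫ t in Set.Ioi (1 : ℝ), inner ℝ x (g (t • x))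

theorem enorm_rayPrimitive_le (g : RN N → RN N) (x : RN N) :
    ‖rayPrimitive g x‖ₑ ≤ rayTail (fun y => ‖g y‖ₑ) x := by
  rw [rayPrimitive, enorm_neg]
  refine (enorm_integral_le_lintegral_enorm _).trans (lintegral_mono fun t => ?_)
  exact enorm_real_inner_le _ _

theorem measurable_rayPrimitive {g : RN N → RN N} (hg : Measurable g) :
    Measurable (rayPrimitive g) := by
  refine StronglyMeasurable.measurable ?_
  refine StronglyMeasurable.neg ?_
  apply StronglyMeasurable.integral_prod_right'
    (f := fun z : RN N × ℝ => inner ℝ z.1 (g (z.2 • z.1)))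
  apply Measurable.stronglyMeasurable
  fun_prop

/-- Joint integrability in `(x, t)`, which justifies Fubini when `φ` is paired with the ray
primitive. -/
theorem integrable_testFunction_mul_inner {g : RN N → RN N} (hg : Measurable g)
    (hB : ∀ K : Set (RN N), IsCompact K → ∫⁻ x in K, rayTail (fun y => ‖g y‖ₑ) x ≠ ∞)
    (φ : 𝓓((⊤ : Opens (RN N)), ℝ)) :
    Integrable (fun z : RN N × ℝ => φ z.1 * inner ℝ z.1 (g (z.2 • z.1)))
      ((volume : Measure (RN N)).prod (volume.restrict (Set.Ioi 1))) := by
  have hφ := φ.continuous.measurable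
  have hm : Measurable fun z : RN N × ℝ => φ z.1 * inner ℝ z.1 (g (z.2 • z.1)) := by fun_prop
  refine ⟨hm.aestronglyMeasurable, ?_⟩
  obtain ⟨M, hM⟩ := φ.hasCompactSupport.exists_bound_of_continuous φ.continuous
  have hB' := hB _ φ.hasCompactSupport.isCompact
  rw [HasFiniteIntegral, lintegral_prod _ hm.enorm.aemeasurable]
  calc ∫⁻ x, ∫⁻ t in Set.Ioi (1 : ℝ), ‖φ x * inner ℝ x (g (t • x))‖ₑ
      ≤ ∫⁻ x in tsupport φ, ENNReal.ofReal M * rayTail (fun y => ‖g y‖ₑ) x := by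
        rw [← lintegral_indicator (isClosed_tsupport φ).measurableSet]
        refine lintegral_mono fun x => ?_
        by_cases hx : x ∈ tsupport φ
        · rw [Set.indicator_of_mem hx, rayTail, ← lintegral_const_mul' _ _ ENNReal.ofReal_ne_top]
          refine lintegral_mono fun t => ?_
          rw [enorm_mul]
          gcongr
          · rw [← ofReal_norm]
            exact ENNReal.ofReal_le_ofReal (hM x)
          · exact enorm_real_inner_le _ _
        · simp [image_eq_zero_of_notMem_tsupport hx]
    _ = ENNReal.ofReal M * ∫⁻ x in tsupport φ, rayTail (fun y => ‖g y‖ₑ) x :=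
        lintegral_const_mul' _ _ ENNReal.ofReal_ne_top
    _ < ∞ := ENNReal.mul_lt_top ENNReal.ofReal_lt_top hB'.lt_top

theorem locallyIntegrable_rayPrimitive {g : RN N → RN N} (hg : Measurable g)
    (hB : ∀ K : Set (RN N), IsCompact K → ∫⁻ x in K, rayTail (fun y => ‖g y‖ₑ) x ≠ ∞) :
    LocallyIntegrable (rayPrimitive g) volume := by
  refine locallyIntegrable_iff.2 fun K hK =>
    ⟨(measurable_rayPrimitive hg).aestronglyMeasurable, ?_⟩
  exact (lintegral_mono fun x => enorm_rayPrimitive_le g x).trans_lt (hB K hK).lt_top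

theorem GradRepresents.apply_sub_apply_dilate {u : Distr N} {g : RN N → RN N}
    (hu : GradRepresents u g) (hg : Measurable g) (φ : 𝓓((⊤ : Opens (RN N)), ℝ))
    {T : ℝ} (hT : 1 ≤ T) :
    u φ - u (dilate T (by positivity) φ) =
      -∫ t in Set.Ioc 1 T, ∫ x, φ x * inner ℝ x (g (t • x)) := by
  have hgl := hu.locallyIntegrable
  obtain ⟨Ψ, hΨ, hdiv⟩ := exists_divergence_eq_sub_dilate φ hT
  rw [← map_sub, ← hdiv, map_sum, Finset.sum_congr rfl fun i _ => hu.apply_lineDeriv i (Ψ i),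
    Finset.sum_neg_distrib, neg_inj,
    ← integral_finsetSum _ fun i _ => integrable_testFunction_mul (hu i).1 (Ψ i)]
  have h1 : ∀ y, ∑ i, Ψ i y * g y i =
      ∫ t in Set.Ioc 1 T, (t ^ (N + 1))⁻¹ * φ (t⁻¹ • y) * inner ℝ y (g y) := by
    intro y
    rw [integral_mul_const, PiLp.inner_apply, Finset.mul_sum]
    refine Finset.sum_congr rfl fun i _ => ?_
    rw [hΨ]
    simp only [RCLike.inner_apply, conj_trivial]
    ring
  simp only [h1]
  -- After Fubini, `y = t x` produces `t^N` and `y · g(y)` produces a further `t`, which together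
  -- cancel `t^(-N-1)`.
  rw [integral_integral_swap]
  · refine setIntegral_congr_fun measurableSet_Ioc fun t ht => ?_
    have ht0 : 0 < t := one_pos.trans ht.1
    have h2 := Measure.integral_comp_smul_of_nonneg (volume : Measure (RN N))
      (fun y => (t ^ (N + 1))⁻¹ * φ (t⁻¹ • y) * inner ℝ y (g y)) t (hR := ht0.le)
    rw [finrank_euclideanSpace_fin, smul_eq_mul, eq_inv_mul_iff_mul_eq₀ (by positivity),
      ← integral_const_mul] at h2
    rw [← h2]
    refine integral_congr_ae (Eventually.of_forall fun x => ?_)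
    simp only [smul_smul, inv_mul_cancel₀ ht0.ne', one_smul, real_inner_smul_left]
    field_simp
    ring
  · obtain ⟨M, hM⟩ := φ.hasCompactSupport.exists_bound_of_continuous φ.continuous
    obtain ⟨R, hR, hφR⟩ := exists_norm_le_of_ne_zero φ
    have hb : IntegrableOn (fun y => M * (T * R) * ‖g y‖) (Metric.closedBall 0 (T * R)) :=
      ((hgl.integrableOn_isCompact (isCompact_closedBall _ _)).norm).const_mul _
    have hb' := ((integrable_indicator_iff Metric.isClosed_closedBall.measurableSet).2 hb).mul_prod
      (integrable_const (1 : ℝ) : Integrable _ (volume.restrict (Set.Ioc 1 T)))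
    have hφ := φ.continuous.measurable
    refine hb'.mono' (Measurable.aestronglyMeasurable (by
      simp only [Function.uncurry_def]; fun_prop)) ?_
    have h2 : ∀ᵐ p : RN N × ℝ ∂((volume : Measure (RN N)).prod (volume.restrict (Set.Ioc 1 T))),
        p.2 ∈ Set.Ioc (1 : ℝ) T :=
      Measure.quasiMeasurePreserving_snd.ae (ae_restrict_mem measurableSet_Ioc)
    filter_upwards [h2] with p hp
    have hp0 : 0 < p.2 := one_pos.trans hp.1
    have hM0 : 0 ≤ M := (norm_nonneg _).trans (hM 0)
    simp only [Function.uncurry, mul_one]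
    by_cases h0 : φ (p.2⁻¹ • p.1) = 0
    · rw [h0, mul_zero, zero_mul, norm_zero]
      exact Set.indicator_nonneg (fun y _ => by positivity) _
    · have h3 := hφR _ h0
      rw [norm_smul, Real.norm_of_nonneg (by positivity), inv_mul_le_iff₀ hp0] at h3
      have h4 : ‖p.1‖ ≤ T * R := h3.trans (by gcongr; exact hp.2)
      rw [Set.indicator_of_mem (by simpa using h4), norm_mul, norm_mul]
      have h5 : ‖(p.2 ^ (N + 1))⁻¹‖ ≤ 1 := by
        rw [norm_inv, norm_pow, Real.norm_of_nonneg hp0.le]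
        exact inv_le_one_of_one_le₀ (one_le_pow₀ hp.1.le)
      calc ‖(p.2 ^ (N + 1))⁻¹‖ * ‖φ (p.2⁻¹ • p.1)‖ * ‖inner ℝ p.1 (g p.1)‖
          ≤ 1 * M * (T * R * ‖g p.1‖) := by
            gcongr
            · exact hM _
            · exact (norm_inner_le_norm _ _).trans (by gcongr)
        _ = _ := by ring

theorem GradRepresents.tendsto_apply_dilate {u : Distr N} {g : RN N → RN N}
    (hu : GradRepresents u g) (hg : Measurable g)
    (hB : ∀ K : Set (RN N), IsCompact K → ∫⁻ x in K, rayTail (fun y => ‖g y‖ₑ) x ≠ ∞)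
    (φ : 𝓓((⊤ : Opens (RN N)), ℝ)) :
    Tendsto (fun n : ℕ => u (dilate ((n : ℝ) + 1) (by positivity) φ)) atTop
      (𝓝 (u φ - ∫ x, φ x * rayPrimitive g x)) := by
  have hint := integrable_testFunction_mul_inner hg hB φ
  have hm := hint.integral_prod_right
  have hlim : Tendsto (fun n : ℕ => (n : ℝ) + 1) atTop atTop :=
    tendsto_atTop_add_const_right _ _ tendsto_natCast_atTop_atTop
  have h1 := intervalIntegral_tendsto_integral_Ioi 1 hm hlim
  have h2 : ∫ x, φ x * rayPrimitive g x =
      -∫ t in Set.Ioi (1 : ℝ), ∫ x, φ x * inner ℝ x (g (t • x)) := by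
    rw [← integral_integral_swap (f := fun x (t : ℝ) => φ x * inner ℝ x (g (t • x))) hint,
      ← integral_neg]
    refine integral_congr_ae (Eventually.of_forall fun x => ?_)
    simp only [rayPrimitive, integral_const_mul, mul_neg]
  rw [h2, sub_neg_eq_add]
  refine (h1.const_add (u φ)).congr fun n => ?_
  have h3 := hu.apply_sub_apply_dilate hg φ (T := (n : ℝ) + 1) (by simp)
  rw [intervalIntegral.integral_of_le (by simp)]
  linarith

theorem integrable_cutoff_rpow_mul_norm {g : RN N → RN N} (hg : Measurable g)
    (hgl : LocallyIntegrable g volume) (hA : radialTail (fun y => ‖g y‖ₑ) 1 ≠ ∞) :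
    Integrable fun y => (max 1 ‖y‖) ^ (1 - (N : ℝ)) * ‖g y‖ := by
  have hm : Measurable fun y => (max 1 ‖y‖) ^ (1 - (N : ℝ)) * ‖g y‖ := by fun_prop
  rw [← integrableOn_univ, ← Set.union_compl_self (Metric.closedBall (0 : RN N) 1)]
  refine IntegrableOn.union ?_ ?_
  · have h : IntegrableOn (fun y => ‖g y‖) (Metric.closedBall (0 : RN N) 1) :=
      (hgl.integrableOn_isCompact (isCompact_closedBall _ _)).norm
    refine h.congr_fun (fun y hy => ?_)
      Metric.isClosed_closedBall.measurableSet
    simp only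
    rw [max_eq_left (by simpa using hy), Real.one_rpow, one_mul]
  · refine ⟨hm.aestronglyMeasurable, lt_of_le_of_lt ?_ hA.lt_top⟩
    have hset : (Metric.closedBall (0 : RN N) 1)ᶜ = {y | 1 < ‖y‖} := by ext y; simp
    rw [hset, radialTail]
    refine setLIntegral_mono' (measurableSet_lt_norm 1) fun y hy => le_of_eq ?_
    rw [enorm_mul, enorm_norm, Real.enorm_of_nonneg (by positivity),
      max_eq_right (le_of_lt hy)]

/-- Each component contributes `-T^(1-N) ∫ Ψ_i(y/T) g_i`. On the support `|y| ≤ T R`, so `T^(1-N)`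
is at most a constant times `max(1, |y|)^(1-N)`; this gives an integrable majorant, while for fixed
`y` the integrand tends to `0` since `N > 1`. -/
theorem GradRepresents.tendsto_apply_dilate_divergence (hN : 1 < N) {u : Distr N}
    {g : RN N → RN N} (hu : GradRepresents u g) (hg : Measurable g)
    (hA : radialTail (fun y => ‖g y‖ₑ) 1 ≠ ∞) (Ψ : Fin N → 𝓓((⊤ : Opens (RN N)), ℝ)) :
    Tendsto (fun n : ℕ => u (dilate ((n : ℝ) + 1) (by positivity)
      (∑ i, ∂_{(EuclideanSpace.single i (1 : ℝ) : RN N)} (Ψ i)))) atTop (𝓝 0) := by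
  have hgl := hu.locallyIntegrable
  have hI := integrable_cutoff_rpow_mul_norm hg hgl hA
  have key : ∀ i, Tendsto (fun n : ℕ =>
      ∫ y, ((n : ℝ) + 1) * (dilate ((n : ℝ) + 1) (by positivity) (Ψ i) y * g y i)) atTop
      (𝓝 0) := by
    intro i
    obtain ⟨M, hM⟩ := (Ψ i).hasCompactSupport.exists_bound_of_continuous (Ψ i).continuous
    have hM0 : 0 ≤ M := (norm_nonneg _).trans (hM 0)
    obtain ⟨R, hR, hR'⟩ := exists_norm_le_of_ne_zero (Ψ i)
    -- From `max 1 |y| ≤ T max(1, R)` on the support, raised to the power `N - 1`.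
    set D : ℝ := (max 1 R) ^ ((N : ℝ) - 1) with hD
    have hD0 : 0 ≤ D := by positivity
    have hN1 : (0 : ℝ) < (N : ℝ) - 1 := by
      have : (1 : ℝ) < N := by exact_mod_cast hN
      linarith
    have hpow : ∀ n : ℕ, ((n : ℝ) + 1) * (((n : ℝ) + 1) ^ N)⁻¹ = ((n : ℝ) + 1) ^ (1 - (N : ℝ)) :=
      fun n => by
        rw [Real.rpow_sub (by positivity), Real.rpow_one, Real.rpow_natCast, div_eq_mul_inv]
    have hgi : ∀ y, |g y i| ≤ ‖g y‖ := fun y => PiLp.norm_apply_le (g y) i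
    have hval : ∀ (n : ℕ) y, ((n : ℝ) + 1) *
        (dilate ((n : ℝ) + 1) (by positivity) (Ψ i) y * g y i) =
        ((n : ℝ) + 1) ^ (1 - (N : ℝ)) * (Ψ i (((n : ℝ) + 1)⁻¹ • y) * g y i) := fun n y => by
      rw [dilate_apply, ← hpow]; ring
    simp only [hval]
    have := tendsto_integral_filter_of_dominated_convergence (μ := (volume : Measure (RN N)))
      (F := fun (n : ℕ) y => ((n : ℝ) + 1) ^ (1 - (N : ℝ)) *
        (Ψ i (((n : ℝ) + 1)⁻¹ • y) * g y i)) (f := fun _ => 0) (l := atTop)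
      (fun y => D * M * ((max 1 ‖y‖) ^ (1 - (N : ℝ)) * ‖g y‖)) ?_ ?_ (hI.const_mul _) ?_
    · simpa using this
    · refine Eventually.of_forall fun n => Measurable.aestronglyMeasurable ?_
      have := (Ψ i).continuous.measurable
      have : Measurable fun y => g y i := (EuclideanSpace.proj i : RN N →L[ℝ] ℝ).measurable.comp hg
      fun_prop
    · refine Eventually.of_forall fun n => Eventually.of_forall fun y => ?_
      set T : ℝ := (n : ℝ) + 1 with hT
      have hT1 : 1 ≤ T := by simp [hT]
      have hT0 : 0 < T := by linarith
      rw [norm_mul, norm_mul, Real.norm_of_nonneg (by positivity), Real.norm_eq_abs (g y i)]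
      by_cases h0 : Ψ i (T⁻¹ • y) = 0
      · rw [h0, norm_zero, zero_mul, mul_zero]; positivity
      have h3 := hR' _ h0
      rw [norm_smul, Real.norm_of_nonneg (by positivity), inv_mul_le_iff₀ hT0] at h3
      have h4 : T ^ (1 - (N : ℝ)) ≤ D * (max 1 ‖y‖) ^ (1 - (N : ℝ)) := by
        have hm1 : (1 : ℝ) ≤ max 1 R := le_max_left _ _
        have hm2 : 0 < max 1 ‖y‖ := lt_of_lt_of_le one_pos (le_max_left _ _)
        rw [hD, show (1 - (N : ℝ)) = -((N : ℝ) - 1) by ring, Real.rpow_neg hT0.le,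
          Real.rpow_neg hm2.le, ← div_eq_mul_inv, ← Real.div_rpow (by positivity) hm2.le,
          ← Real.inv_rpow hT0.le]
        refine Real.rpow_le_rpow (by positivity) ?_ hN1.le
        rw [le_div_iff₀ hm2, inv_mul_le_iff₀ hT0]
        refine max_le (one_le_mul_of_one_le_of_one_le hT1 hm1) (h3.trans ?_)
        gcongr
        exact le_max_right _ _
      calc T ^ (1 - (N : ℝ)) * (‖Ψ i (T⁻¹ • y)‖ * |g y i|)
          ≤ D * (max 1 ‖y‖) ^ (1 - (N : ℝ)) * (M * ‖g y‖) := by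
            gcongr
            · exact hM _
            · exact hgi y
        _ = _ := by ring
    · refine Eventually.of_forall fun y => ?_
      refine squeeze_zero_norm (a := fun n : ℕ => ((n : ℝ) + 1) ^ (1 - (N : ℝ)) * (M * ‖g y‖))
        (fun n => ?_) ?_
      · rw [norm_mul, norm_mul, Real.norm_of_nonneg (by positivity), Real.norm_eq_abs (g y i)]
        gcongr
        · exact hM _
        · exact hgi y
      · have hlim : Tendsto (fun n : ℕ => (n : ℝ) + 1) atTop atTop :=
          tendsto_atTop_add_const_right _ _ tendsto_natCast_atTop_atTop
        have := ((tendsto_rpow_neg_atTop hN1).comp hlim).mul_const (M * ‖g y‖)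
        simpa using this
  have hsum := (tendsto_finsetSum Finset.univ fun i _ => key i).neg
  simp only [Finset.sum_const_zero, neg_zero] at hsum
  refine hsum.congr fun n => ?_
  have h1 : dilate ((n : ℝ) + 1) (by positivity)
      (∑ i, ∂_{(EuclideanSpace.single i (1 : ℝ) : RN N)} (Ψ i)) =
      ∑ i, ((n : ℝ) + 1) • ∂_{(EuclideanSpace.single i (1 : ℝ) : RN N)}
        (dilate ((n : ℝ) + 1) (by positivity) (Ψ i)) := by
    refine Eq.trans ?_ (Finset.sum_congr rfl fun i _ =>
      dilate_lineDeriv (by positivity : (n : ℝ) + 1 ≠ 0) (Ψ i) (EuclideanSpace.single i (1 : ℝ)))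
    ext x
    simp [dilate_apply, Finset.mul_sum]
  rw [h1, map_sum, ← Finset.sum_neg_distrib]
  refine Finset.sum_congr rfl fun i _ => ?_
  rw [map_smul, hu.apply_lineDeriv, integral_const_mul, smul_eq_mul, mul_neg]

/-- For the mean-zero function `φ - (∫ φ) η` with `∫ η = 1`, the values of `u` on the dilates have
two limits: `0`, as it is a divergence, and the defect between `u` and `rayPrimitive g`. Their
equality fixes `c` as the defect at `η`. -/
theorem GradRepresents.exists_sub_const_eq (hN : 1 < N) {u : Distr N}
    {g : RN N → RN N} (hu : GradRepresents u g) (hg : Measurable g)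
    (hA : radialTail (fun y => ‖g y‖ₑ) 1 ≠ ∞)
    (hB : ∀ K : Set (RN N), IsCompact K → ∫⁻ x in K, rayTail (fun y => ‖g y‖ₑ) x ≠ ∞) :
    ∃ c : ℝ, Represents (u - constDistr N c) (rayPrimitive g) := by
  have hv := locallyIntegrable_rayPrimitive hg hB
  obtain ⟨η, hη⟩ := exists_testFunction_integral_eq_one (N := N)
  refine ⟨u η - ∫ x, η x * rayPrimitive g x, hv, ?_⟩
  ext φ
  change u φ - constDistr N _ φ = _
  rw [constDistr_apply, distrOfFun_apply hv]
  obtain ⟨Ψ, hΨ⟩ := exists_divergence_of_integral φ η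
  rw [hη, one_smul] at hΨ
  have h1 := hu.tendsto_apply_dilate_divergence hN hg hA Ψ
  rw [hΨ] at h1
  have h2 := hu.tendsto_apply_dilate hg hB (φ - (∫ a, φ a) • η)
  have h3 := tendsto_nhds_unique h1 h2
  have h4 : ∫ x, (φ - (∫ a, φ a) • η) x * rayPrimitive g x =
      (∫ x, φ x * rayPrimitive g x) - (∫ a, φ a) * ∫ x, η x * rayPrimitive g x := by
    rw [← integral_const_mul, ← integral_sub (integrable_testFunction_mul hv φ)
      ((integrable_testFunction_mul hv η).const_mul _)]
    refine integral_congr_ae (Eventually.of_forall fun x => ?_)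
    change (φ x - (∫ a, φ a) * η x) * _ = _
    ring
  rw [h4, map_sub, map_smul, smul_eq_mul] at h3
  linarith

end RayPrimitive

/-! ### Polar coordinates and spherical means -/

section Polar

variable {N : ℕ}

/-- Polar coordinates `(ω, r) ↦ r ω`. -/
noncomputable def polarMap (N : ℕ) (z : Metric.sphere (0 : RN N) 1 × Set.Ioi (0 : ℝ)) : RN N :=
  ((homeomorphUnitSphereProd (RN N)).symm z : RN N)

theorem polarMap_apply (z : Metric.sphere (0 : RN N) 1 × Set.Ioi (0 : ℝ)) :
    polarMap N z = z.2.1 • z.1.1 := rfl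

theorem norm_polarMap (z : Metric.sphere (0 : RN N) 1 × Set.Ioi (0 : ℝ)) :
    ‖polarMap N z‖ = z.2.1 := by
  rw [polarMap_apply, norm_smul, Real.norm_of_nonneg (le_of_lt z.2.2),
    mem_sphere_zero_iff_norm.1 z.1.2, mul_one]

theorem measurableEmbedding_polarMap : MeasurableEmbedding (polarMap N) :=
  (MeasurableEmbedding.subtype_coe (measurableSet_singleton (0 : RN N)).compl).comp
    (homeomorphUnitSphereProd (RN N)).symm.measurableEmbedding

theorem measurePreserving_polarMap (hN : 0 < N) :
    MeasurePreserving (polarMap N)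
      ((volume : Measure (RN N)).toSphere.prod (Measure.volumeIoiPow (N - 1))) volume := by
  have : Nonempty (Fin N) := ⟨⟨0, hN⟩⟩
  have h1 := (volume : Measure (RN N)).measurePreserving_homeomorphUnitSphereProd
  rw [finrank_euclideanSpace_fin] at h1
  have h2 : MeasurePreserving (homeomorphUnitSphereProd (RN N)).symm
      ((volume : Measure (RN N)).toSphere.prod (Measure.volumeIoiPow (N - 1)))
      (volume.comap (Subtype.val : ({0}ᶜ : Set (RN N)) → RN N)) :=
    MeasurePreserving.symm (homeomorphUnitSphereProd (RN N)).toMeasurableEquiv h1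
  have h3 := measurePreserving_subtype_coe (μa := (volume : Measure (RN N)))
    (measurableSet_singleton (0 : RN N)).compl
  have h4 : ∀ᵐ x : RN N, x ∈ ({0}ᶜ : Set (RN N)) := compl_mem_ae_iff.2 (measure_singleton _)
  rw [Measure.restrict_eq_self_of_ae_mem h4] at h3
  exact h3.comp h2

theorem ae_iff_ae_polarMap (hN : 0 < N) {p : RN N → Prop} :
    (∀ᵐ x, p x) ↔ ∀ᵐ z ∂(volume : Measure (RN N)).toSphere.prod (Measure.volumeIoiPow (N - 1)),
      p (polarMap N z) := by
  conv_lhs => rw [← (measurePreserving_polarMap hN).map_eq]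
  rw [measurableEmbedding_polarMap.ae_map_iff]

theorem integral_volumeIoiPow (n : ℕ) (f : ℝ → ℝ) :
    ∫ r : Set.Ioi (0 : ℝ), f r ∂Measure.volumeIoiPow n = ∫ r in Set.Ioi (0 : ℝ), r ^ n * f r := by
  rw [Measure.volumeIoiPow, integral_withDensity_eq_integral_toReal_smul (by fun_prop)
    (Eventually.of_forall fun r => ENNReal.ofReal_lt_top)]
  rw [integral_subtype_comap measurableSet_Ioi
    (fun a : ℝ => (ENNReal.ofReal (a ^ n)).toReal • f a)]
  refine setIntegral_congr_fun measurableSet_Ioi fun r hr => ?_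
  have : (0 : ℝ) < r := hr
  simp only [smul_eq_mul, ENNReal.toReal_ofReal (by positivity : (0 : ℝ) ≤ r ^ n)]

theorem integral_eq_integral_sphere (hN : 0 < N) {F : RN N → ℝ} (hF : Integrable F) :
    ∫ x, F x = ∫ ω : Metric.sphere (0 : RN N) 1, (∫ r in Set.Ioi (0 : ℝ),
      r ^ (N - 1) * F (r • ω.1)) ∂(volume : Measure (RN N)).toSphere := by
  have h1 := (measurePreserving_polarMap hN).integral_comp measurableEmbedding_polarMap F
  have h2 := (measurePreserving_polarMap hN).integrable_comp_of_integrable hF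
  rw [← h1]
  refine (integral_prod _ h2).trans ?_
  refine integral_congr_ae (Eventually.of_forall fun ω => ?_)
  exact integral_volumeIoiPow (N - 1) (fun r => F (r • ω.1))

/-- The total mass of the unit sphere. -/
noncomputable def sphereMass (N : ℕ) : ℝ := (volume : Measure (RN N)).toSphere.real Set.univ

theorem sphereMass_pos (hN : 0 < N) : 0 < sphereMass N := by
  have : Nonempty (Fin N) := ⟨⟨0, hN⟩⟩
  have h : (volume : Measure (RN N)).toSphere ≠ 0 := Measure.toSphere_ne_zero _
  have : NeZero (volume : Measure (RN N)).toSphere := ⟨h⟩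
  exact measureReal_univ_pos

/-- The average over the spheres centred at the origin of `rayPrimitive g`, as a function of the
radius. -/
noncomputable def radialPrimitive (g : RN N → RN N) (r : ℝ) : ℝ :=
  -(sphereMass N)⁻¹ * ∫ y in {y : RN N | r < ‖y‖}, ‖y‖ ^ (-(N : ℝ)) * inner ℝ y (g y)

theorem enorm_radialPrimitive_integrand_le (g : RN N → RN N) (y : RN N) :
    ‖‖y‖ ^ (-(N : ℝ)) * inner ℝ y (g y)‖ₑ ≤ ENNReal.ofReal (‖y‖ ^ (1 - (N : ℝ))) * ‖g y‖ₑ := by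
  rcases eq_or_ne y 0 with rfl | hy
  · simp
  have hy0 : 0 < ‖y‖ := norm_pos_iff.2 hy
  rw [enorm_mul, Real.enorm_of_nonneg (by positivity)]
  refine (mul_le_mul_right (enorm_real_inner_le y (g y)) _).trans_eq ?_
  rw [← mul_assoc, ← ofReal_norm y, ← ENNReal.ofReal_mul (by positivity),
    ← Real.rpow_add_one hy0.ne', neg_add_eq_sub]

theorem integrableOn_radialPrimitive_integrand {g : RN N → RN N} (hg : Measurable g) {r : ℝ}
    (hr : radialTail (fun y => ‖g y‖ₑ) r ≠ ∞) :
    IntegrableOn (fun y => ‖y‖ ^ (-(N : ℝ)) * inner ℝ y (g y)) {y : RN N | r < ‖y‖} :=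
  ⟨(by fun_prop : Measurable fun y => ‖y‖ ^ (-(N : ℝ)) * inner ℝ y (g y)).aestronglyMeasurable,
    (lintegral_mono fun y => enorm_radialPrimitive_integrand_le g y).trans_lt hr.lt_top⟩

theorem enorm_radialPrimitive_le (g : RN N → RN N) (r : ℝ) :
    ‖radialPrimitive g r‖ₑ ≤
      ENNReal.ofReal (sphereMass N)⁻¹ * radialTail (fun y => ‖g y‖ₑ) r := by
  have h0 : 0 ≤ (sphereMass N)⁻¹ := inv_nonneg.2 measureReal_nonneg
  rw [radialPrimitive, enorm_mul, enorm_neg, Real.enorm_of_nonneg h0]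
  gcongr
  exact (enorm_integral_le_lintegral_enorm _).trans
    (lintegral_mono fun y => enorm_radialPrimitive_integrand_le g y)

theorem rayPrimitive_polar (g : RN N → RN N) {r : ℝ} (hr : 0 < r) (ω : RN N) :
    rayPrimitive g (r • ω) = -∫ τ in Set.Ioi r, inner ℝ ω (g (τ • ω)) := by
  have h := integral_comp_mul_right_Ioi (fun τ : ℝ => (inner ℝ ω (g (τ • ω)) : ℝ)) 1 hr
  rw [one_mul, smul_eq_mul, eq_inv_mul_iff_mul_eq₀ hr.ne', ← integral_const_mul] at h
  rw [rayPrimitive, ← h]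
  simp only [real_inner_smul_left, smul_smul]

/-- Along the ray of direction `ω` the primitive is `-∫_r^∞ ω · g(τ ω) dτ`. Integrating over `ω`
undoes polar coordinates: the Jacobian `τ^(N-1)`, the weight `τ^(-N)` and the factor `τ` from `y = τ
ω` multiply to `1`. -/
theorem integral_sphere_rayPrimitive (hN : 0 < N) {g : RN N → RN N} (hg : Measurable g) {r : ℝ}
    (hr0 : 0 < r) (hr : radialTail (fun y => ‖g y‖ₑ) r ≠ ∞) :
    ∫ ω : Metric.sphere (0 : RN N) 1, rayPrimitive g (r • ω.1)
      ∂(volume : Measure (RN N)).toSphere = sphereMass N * radialPrimitive g r := by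
  have hS : MeasurableSet {y : RN N | r < ‖y‖} := measurableSet_lt_norm r
  rw [radialPrimitive, ← mul_assoc, mul_neg, mul_inv_cancel₀ (sphereMass_pos hN).ne', neg_one_mul,
    ← integral_indicator hS, integral_eq_integral_sphere hN
      ((integrable_indicator_iff hS).2 (integrableOn_radialPrimitive_integrand hg hr)),
    ← integral_neg]
  refine integral_congr_ae (Eventually.of_forall fun ω => ?_)
  have hω : ‖ω.1‖ = 1 := mem_sphere_zero_iff_norm.1 ω.2
  simp only
  rw [rayPrimitive_polar g hr0, neg_inj]
  have h1 : ∀ τ ∈ Set.Ioi (0 : ℝ), τ ^ (N - 1) * {y : RN N | r < ‖y‖}.indicator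
      (fun y => ‖y‖ ^ (-(N : ℝ)) * inner ℝ y (g y)) (τ • ω.1) =
      (Set.Ioi r).indicator (fun τ => inner ℝ ω.1 (g (τ • ω.1))) τ := by
    intro τ hτ
    have hτ0 : 0 < τ := hτ
    have hn : ‖τ • ω.1‖ = τ := by rw [norm_smul, hω, mul_one, Real.norm_of_nonneg hτ0.le]
    by_cases h : r < τ
    · rw [Set.indicator_of_mem (by simpa only [Set.mem_ofPred_eq, hn] using h),
        Set.indicator_of_mem (Set.mem_Ioi.2 h), hn, real_inner_smul_left, Real.rpow_neg hτ0.le,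
        Real.rpow_natCast]
      have : τ ^ N = τ ^ (N - 1) * τ := by rw [← pow_succ, Nat.sub_add_cancel hN]
      rw [this]
      field_simp
    · rw [Set.indicator_of_notMem (by simpa only [Set.mem_ofPred_eq, hn] using h),
        Set.indicator_of_notMem (by simpa using h), mul_zero]
  rw [setIntegral_congr_fun measurableSet_Ioi h1, setIntegral_indicator measurableSet_Ioi,
    Set.Ioi_inter_Ioi, max_eq_right hr0.le]

/-- By Fubini, on almost every sphere the ray primitive is almost everywhere the constant `h r`,
hence equal to its mean over that sphere. -/
theorem rayPrimitive_ae_eq_radialPrimitive (hN : 0 < N) {g : RN N → RN N} (hg : Measurable g)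
    (hA : ∀ r : ℝ, 0 < r → radialTail (fun y => ‖g y‖ₑ) r ≠ ∞) {h : ℝ → ℝ}
    (hh : ∀ᵐ x : RN N, rayPrimitive g x = h ‖x‖) :
    ∀ᵐ x : RN N, rayPrimitive g x = radialPrimitive g ‖x‖ := by
  rw [ae_iff_ae_polarMap hN] at hh
  -- The factors are swapped so that Fubini gives almost every radius first, then almost every
  -- direction.
  have h1 := (Measure.measurePreserving_swap
    (μ := Measure.volumeIoiPow (N - 1))
    (ν := (volume : Measure (RN N)).toSphere)).quasiMeasurePreserving.ae hh
  have h2 := Measure.ae_ae_of_ae_prod h1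
  have h3 : ∀ᵐ r : Set.Ioi (0 : ℝ) ∂Measure.volumeIoiPow (N - 1), h r.1 = radialPrimitive g r.1 := by
    filter_upwards [h2] with r hr
    have h4 := integral_sphere_rayPrimitive hN hg r.2 (hA r.1 r.2)
    have h5 : ∀ᵐ ω : Metric.sphere (0 : RN N) 1 ∂(volume : Measure (RN N)).toSphere,
        rayPrimitive g (r.1 • ω.1) = h r.1 := by
      filter_upwards [hr] with ω hω
      rw [Prod.swap_prod_mk, norm_polarMap] at hω
      exact hω
    rw [integral_congr_ae h5, integral_const, smul_eq_mul] at h4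
    exact mul_left_cancel₀ (sphereMass_pos hN).ne' h4
  rw [ae_iff_ae_polarMap hN]
  filter_upwards [hh, Measure.quasiMeasurePreserving_snd.ae h3] with z hz hz'
  rw [hz, norm_polarMap, hz']

/-- Dominated convergence: the indicator of `|z| < |y|` is locally constant in `z` near `x` unless
`|y| = |x|`, and spheres are null sets. -/
theorem continuous_radialPrimitive_norm (hN : 0 < N) {g : RN N → RN N} (hg : Measurable g)
    (hA : radialTail (fun y => ‖g y‖ₑ) 0 ≠ ∞) :
    Continuous fun x : RN N => radialPrimitive g ‖x‖ := by
  have : Nonempty (Fin N) := ⟨⟨0, hN⟩⟩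
  set f : RN N → ℝ := fun y => ‖y‖ ^ (-(N : ℝ)) * inner ℝ y (g y) with hf
  have hfm : Measurable f := by fun_prop
  have hint := integrableOn_radialPrimitive_integrand hg hA
  have hint' := (integrable_indicator_iff (measurableSet_lt_norm (0 : ℝ))).2 hint
  simp only [radialPrimitive]
  refine continuous_const.mul ?_
  refine continuous_iff_continuousAt.2 fun x => ?_
  simp only [← integral_indicator (measurableSet_lt_norm _)]
  refine continuousAt_of_dominated (bound := fun y => ‖{y : RN N | 0 < ‖y‖}.indicator f y‖)
    (Eventually.of_forall fun z =>
      (hfm.indicator (measurableSet_lt_norm _)).aestronglyMeasurable)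
    (Eventually.of_forall fun z => Eventually.of_forall fun y => ?_) hint'.norm ?_
  · by_cases hy : ‖z‖ < ‖y‖
    · rw [Set.indicator_of_mem (by exact hy),
        Set.indicator_of_mem (by exact lt_of_le_of_lt (norm_nonneg z) hy)]
    · rw [Set.indicator_of_notMem (by exact hy), norm_zero]
      exact norm_nonneg _
  · have hnull : ∀ᵐ y : RN N, ‖y‖ ≠ ‖x‖ := by
      rw [ae_iff]
      refine measure_mono_null (fun y hy => ?_) (Measure.addHaar_sphere volume (0 : RN N) ‖x‖)
      simpa using hy
    filter_upwards [hnull] with y hy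
    rcases lt_or_gt_of_ne hy with h | h
    · have : ∀ᶠ z in 𝓝 x, ‖y‖ < ‖z‖ := continuous_norm.continuousAt.eventually_const_lt h
      refine ContinuousAt.congr (continuousAt_const (y := (0 : ℝ))) ?_
      filter_upwards [this] with z hz
      rw [Set.indicator_of_notMem (by exact not_lt.2 hz.le)]
    · have : ∀ᶠ z in 𝓝 x, ‖z‖ < ‖y‖ := continuous_norm.continuousAt.eventually_lt_const h
      refine ContinuousAt.congr (continuousAt_const (y := f y)) ?_
      filter_upwards [this] with z hz
      rw [Set.indicator_of_mem (by exact hz)]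

end Polar

/-! ### Weighted norm estimates for the tails -/

section WeightedEstimates

variable {N : ℕ}

/-- The `P`-th power of the norm of `(1 + |x|)^a G` in `L^P`. -/
noncomputable def weightedEnergy (a P : ℝ) (G : RN N → ℝ≥0∞) : ℝ≥0∞ :=
  ∫⁻ x, (ENNReal.ofReal ((1 + ‖x‖) ^ a) * G x) ^ P

theorem radialTail_ne_top {a P : ℝ} (hN : 0 < N) (hP : 1 ≤ P) (ha : 1 < a + N / P)
    {G : RN N → ℝ≥0∞} (hG : Measurable G) (hE : weightedEnergy a P G ≠ ∞) {r : ℝ} (hr : 0 < r) :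
    radialTail G r ≠ ∞ := by
  have hP0 : 0 < P := by linarith
  obtain ⟨C, hC, h⟩ := exists_radialTail_rpow_le N hP le_rfl zero_le_one
    (by have : (0 : ℝ) < N := by exact_mod_cast hN
        positivity) ha
  intro htop
  have h1 := h G hG r hr
  rw [htop, ENNReal.mul_top (by
    have : 0 < r ^ (N / P) * (r ^ (-(0 : ℝ)) * (1 + r) ^ (a - 1 + 0)) := by positivity
    exact (ENNReal.ofReal_pos.2 this).ne'), ENNReal.top_rpow_of_pos hP0, top_le_iff] at h1
  refine ENNReal.mul_ne_top ENNReal.ofReal_ne_top ?_ h1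
  exact ne_top_of_le_ne_top hE (setLIntegral_le_lintegral _ _)

/-- Hardy with `θ = 0` and Jensen on `K`, where the weight is bounded below by a positive constant.
-/
theorem setLIntegral_rayTail_ne_top {a P : ℝ} (hN : 0 < N) (hP : 1 ≤ P) (ha : 1 < a + N / P)
    {G : RN N → ℝ≥0∞} (hG : Measurable G) (hE : weightedEnergy a P G ≠ ∞) {K : Set (RN N)}
    (hK : IsCompact K) : ∫⁻ x in K, rayTail G x ≠ ∞ := by
  have hP0 : 0 < P := by linarith
  obtain ⟨C, hC, h⟩ := exists_lintegral_rayTail_rpow_le N hP zero_le_one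
    (by have : (0 : ℝ) < N := by exact_mod_cast hN
        positivity) ha
  have h1 := h G hG
  have hm := measurable_rayTail hG
  have hcont : Continuous fun x : RN N => (1 + ‖x‖) ^ (-(a - 1 + 0)) :=
    (by fun_prop : Continuous fun x : RN N => 1 + ‖x‖).rpow_const fun x =>
      Or.inl (by positivity)
  obtain ⟨M, hM⟩ := hK.exists_bound_of_continuousOn hcont.continuousOn
  set F : RN N → ℝ≥0∞ := fun x =>
    ENNReal.ofReal (‖x‖ ^ (-(0 : ℝ)) * (1 + ‖x‖) ^ (a - 1 + 0)) * rayTail G x with hF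
  have hFP : ∫⁻ x in K, F x ≠ ∞ := by
    have h2 : (∫⁻ x in K, F x) ^ P ≠ ∞ := by
      refine ne_top_of_le_ne_top ?_ (rpow_lintegral_le hP (by fun_prop))
      refine ENNReal.mul_ne_top (ENNReal.rpow_ne_top_of_nonneg (by linarith) ?_) ?_
      · rw [Measure.restrict_apply_univ]; exact hK.measure_lt_top.ne
      · refine ne_top_of_le_ne_top ?_ ((setLIntegral_le_lintegral _ _).trans h1)
        exact ENNReal.mul_ne_top ENNReal.ofReal_ne_top hE
    intro htop
    rw [htop, ENNReal.top_rpow_of_pos hP0] at h2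
    exact h2 rfl
  refine ne_top_of_le_ne_top (ENNReal.mul_ne_top ENNReal.ofReal_ne_top hFP)
    (b := ENNReal.ofReal M * ∫⁻ x in K, F x) ?_
  rw [← lintegral_const_mul' _ _ ENNReal.ofReal_ne_top]
  refine setLIntegral_mono' hK.measurableSet fun x hx => ?_
  have hMx := hM x hx
  rw [Real.norm_of_nonneg (by positivity), Real.rpow_neg (by positivity),
    inv_le_iff_one_le_mul₀ (by positivity)] at hMx
  rw [hF, ← mul_assoc, ← ENNReal.ofReal_mul' (by positivity), neg_zero, Real.rpow_zero, one_mul]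
  exact le_mul_of_one_le_left zero_le (by simpa using hMx)

theorem exists_rayTail_energy_le (hN : 0 < N) {a P : ℝ} (hP : 1 ≤ P) (ha : 1 < a + N / P) :
    ∃ C : ℝ, 0 < C ∧ ∀ (v : RN N → ℝ≥0∞) (G : RN N → ℝ≥0∞), Measurable G →
      (∀ᵐ x, v x ≤ rayTail G x) →
      weightedEnergy (a - 1) P v ^ (1 / P) ≤ ENNReal.ofReal C * weightedEnergy a P G ^ (1 / P) := by
  have hP0 : 0 < P := by linarith
  obtain ⟨C, hC, h⟩ := exists_lintegral_rayTail_rpow_le N hP zero_le_one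
    (by have : (0 : ℝ) < N := by exact_mod_cast hN
        positivity) ha
  refine ⟨C ^ (1 / P), by positivity, fun v G hG hv => ?_⟩
  rw [← ENNReal.ofReal_rpow_of_pos hC, ← ENNReal.mul_rpow_of_nonneg _ _ (by positivity)]
  gcongr
  refine le_trans ?_ (h G hG)
  refine lintegral_mono_ae ?_
  filter_upwards [hv] with x hx
  rw [neg_zero, Real.rpow_zero, one_mul, add_zero]
  gcongr

theorem rpow_one_div_le_of_rpow_le {P C : ℝ} (hP : 0 < P) (hC : 0 < C) {A E : ℝ≥0∞}
    (h : A ^ P ≤ ENNReal.ofReal C * E) : A ≤ ENNReal.ofReal (C ^ (1 / P)) * E ^ (1 / P) := by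
  rw [← ENNReal.ofReal_rpow_of_pos hC, ← ENNReal.mul_rpow_of_nonneg _ _ (by positivity)]
  calc A = (A ^ P) ^ (1 / P) := by
        rw [← ENNReal.rpow_mul, mul_one_div_cancel hP.ne', ENNReal.rpow_one]
    _ ≤ _ := by gcongr

/-- A function dominated by `rayTail G` and by `radialTail G` satisfies weighted estimates in `L^Q`
for all finite exponents `Q` between `P` and the Sobolev exponent. -/
theorem exists_radial_energy_le (hN : 0 < N) {a P Q σ : ℝ} (hP : 1 ≤ P) (hPQ : P ≤ Q)
    (hQ : (N : ℝ) / P - N / Q ≤ 1) (ha : 1 < a + N / P) :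
    ∃ C : ℝ, 0 < C ∧ ∀ (v : RN N → ℝ≥0∞) (G : RN N → ℝ≥0∞), Measurable G →
      (∀ᵐ x, v x ≤ rayTail G x) → (∀ᵐ x, v x ≤ ENNReal.ofReal σ * radialTail G ‖x‖) →
      weightedEnergy (a - 1 + N / P - N / Q) Q v ^ (1 / Q) ≤
        ENNReal.ofReal C * weightedEnergy a P G ^ (1 / P) := by
  have hP0 : 0 < P := by linarith
  have hQ0 : 0 < Q := by linarith
  have hNR : (0 : ℝ) < N := by exact_mod_cast hN
  have : Nonempty (Fin N) := ⟨⟨0, hN⟩⟩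
  set θ : ℝ := N / P - N / Q with hθ
  have hθ0 : 0 ≤ θ := by
    rw [hθ, sub_nonneg]; gcongr
  have hθlt : θ < N / P := by
    have : 0 < (N : ℝ) / Q := by positivity
    linarith
  obtain ⟨C₁, hC₁, h₁⟩ := exists_lintegral_rayTail_rpow_le N hP hQ hθlt ha
  obtain ⟨C₂, hC₂, h₂⟩ := exists_radialTail_rpow_le N hP hθ0 hQ hθlt ha
  set σ' : ℝ := max σ 1 with hσ'
  have hσ0 : 0 < σ' := by positivity
  set D : ℝ := (σ' * C₂ ^ (1 / P)) ^ (Q - P) * C₁ with hD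
  have hD0 : 0 < D := by positivity
  refine ⟨D ^ (1 / Q), by positivity, fun v G hG hv hv' => ?_⟩
  set E := weightedEnergy a P G with hE
  set W : RN N → ℝ := fun x => ‖x‖ ^ (-θ) * (1 + ‖x‖) ^ (a - 1 + θ) with hW
  have hne : ∀ᵐ x : RN N, x ≠ 0 := compl_mem_ae_iff.2 (measure_singleton _)
  have hpt : ∀ᵐ x : RN N, (ENNReal.ofReal ((1 + ‖x‖) ^ (a - 1 + θ)) * v x) ^ Q ≤
      (ENNReal.ofReal (σ' * C₂ ^ (1 / P)) * E ^ (1 / P)) ^ (Q - P) *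
        (ENNReal.ofReal (W x) * rayTail G x) ^ P := by
    filter_upwards [hv, hv', hne] with x hx hx' hx0
    have hr : 0 < ‖x‖ := norm_pos_iff.2 hx0
    set r := ‖x‖ with hrdef
    set y := ENNReal.ofReal ((1 + r) ^ (a - 1 + θ)) * v x with hy
    have hb : ENNReal.ofReal (r ^ ((N : ℝ) / Q)) * y ≤
        ENNReal.ofReal (σ' * C₂ ^ (1 / P)) * E ^ (1 / P) := by
      have h3 := rpow_one_div_le_of_rpow_le hP0 hC₂ ((h₂ G hG r hr).trans
        (mul_le_mul_right (setLIntegral_le_lintegral _ _) _))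
      calc ENNReal.ofReal (r ^ ((N : ℝ) / Q)) * y
          ≤ ENNReal.ofReal (r ^ ((N : ℝ) / Q)) * (ENNReal.ofReal ((1 + r) ^ (a - 1 + θ)) *
            (ENNReal.ofReal σ' * radialTail G r)) := by
            rw [hy]
            gcongr
            exact hx'.trans (by gcongr; exact le_max_left _ _)
        _ = ENNReal.ofReal σ' * (ENNReal.ofReal (r ^ (N / P) *
            (r ^ (-θ) * (1 + r) ^ (a - 1 + θ))) * radialTail G r) := by
            rw [← mul_assoc (r ^ ((N : ℝ) / P)), ← Real.rpow_add hr,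
              show (N : ℝ) / P + -θ = N / Q by rw [hθ]; ring, ENNReal.ofReal_mul (by positivity)]
            ring
        _ ≤ ENNReal.ofReal σ' * (ENNReal.ofReal (C₂ ^ (1 / P)) * E ^ (1 / P)) := by
            gcongr _ * ?_
            exact h3
        _ = _ := by rw [← mul_assoc, ← ENNReal.ofReal_mul hσ0.le]
    -- The powers of `r` cancel by the choice `θ = N/P - N/Q`. The first factor is bounded
    -- pointwise, as `r^(N/P - θ) = r^(N/Q)`; the second is integrated by Hardy's inequality.
    have hsplit : y ^ Q = (ENNReal.ofReal (r ^ ((N : ℝ) / Q)) * y) ^ (Q - P) *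
        (ENNReal.ofReal (r ^ (-θ)) * y) ^ P := by
      rw [ENNReal.mul_rpow_of_nonneg _ _ (by linarith : 0 ≤ Q - P),
        ENNReal.mul_rpow_of_nonneg _ _ hP0.le, mul_mul_mul_comm,
        ← ENNReal.rpow_add_of_nonneg _ _ (by linarith) hP0.le, sub_add_cancel,
        ENNReal.ofReal_rpow_of_pos (by positivity), ENNReal.ofReal_rpow_of_pos (by positivity),
        ← ENNReal.ofReal_mul (by positivity), ← Real.rpow_mul hr.le, ← Real.rpow_mul hr.le,
        ← Real.rpow_add hr, show (N : ℝ) / Q * (Q - P) + -θ * P = 0 by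
          rw [hθ]; field_simp; ring, Real.rpow_zero, ENNReal.ofReal_one, one_mul]
    rw [hsplit]
    gcongr ?_ ^ _ * ?_ ^ _
    · rw [hy, ← mul_assoc, ← ENNReal.ofReal_mul (by positivity)]
      gcongr
  have hae : a - 1 + N / P - N / Q = a - 1 + θ := by rw [hθ]; ring
  refine rpow_one_div_le_of_rpow_le hQ0 hD0 (A := weightedEnergy _ Q v ^ (1 / Q))
    (E := E ^ (Q / P)) ?_ |>.trans_eq ?_
  · rw [← ENNReal.rpow_mul, one_div_mul_cancel hQ0.ne', ENNReal.rpow_one, hae, weightedEnergy]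
    refine (lintegral_mono_ae hpt).trans ?_
    rw [lintegral_const_mul _ (by
      have := measurable_rayTail hG
      fun_prop)]
    refine (mul_le_mul_right (h₁ G hG) _).trans_eq ?_
    change _ * (_ * E) = _
    rw [ENNReal.mul_rpow_of_nonneg _ _ (by linarith : 0 ≤ Q - P),
      ENNReal.ofReal_rpow_of_pos (by positivity), ← ENNReal.rpow_mul, mul_mul_mul_comm,
      ← ENNReal.ofReal_mul (by positivity)]
    congr 1
    conv_lhs => rw [← ENNReal.rpow_one E, ← ENNReal.rpow_mul,
      ← ENNReal.rpow_add_of_nonneg _ _ (by have : 0 ≤ Q - P := by linarith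
                                           positivity) (by norm_num)]
    congr 1
    field_simp
    ring
  · rw [← ENNReal.rpow_mul]
    congr 2
    field_simp

/-- For exponents larger than the dimension, `radialTail G` has a weighted bound. -/
theorem exists_weight_mul_radialTail_le (hN : 0 < N) {a P : ℝ} (hP : 1 ≤ P) (hNP : (N : ℝ) < P)
    (ha : 1 < a + N / P) :
    ∃ C : ℝ, 0 < C ∧ ∀ G : RN N → ℝ≥0∞, Measurable G → ∀ r : ℝ, 0 ≤ r →
      ENNReal.ofReal ((1 + r) ^ (a - 1 + N / P)) * radialTail G r ≤
        ENNReal.ofReal C * weightedEnergy a P G ^ (1 / P) := by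
  have hP0 : 0 < P := by linarith
  have hNR : (0 : ℝ) < N := by exact_mod_cast hN
  obtain ⟨C₁, hC₁, h₁⟩ := exists_radialTail_rpow_le N hP le_rfl zero_le_one
    (by positivity : (0 : ℝ) < N / P) ha
  obtain ⟨C₂, hC₂, h₂⟩ := exists_radialTail_zero_rpow_le N hP hN hNP ha
  refine ⟨2 ^ ((N : ℝ) / P) * C₁ ^ (1 / P) + 2 ^ (a - 1 + N / P) * C₂ ^ (1 / P), by positivity,
    fun G hG r hr => ?_⟩
  set E := weightedEnergy a P G with hE
  -- Near the origin the tail is at most the full tail from radius `0`, the only place where `N < P`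
  -- is needed; for `r ≥ 1` the pointwise bound with `θ = 0` suffices because `1 + r ≤ 2 r`.
  rcases le_total r 1 with hr1 | hr1
  · have h3 := rpow_one_div_le_of_rpow_le hP0 hC₂ (h₂ G hG)
    calc ENNReal.ofReal ((1 + r) ^ (a - 1 + N / P)) * radialTail G r
        ≤ ENNReal.ofReal (2 ^ (a - 1 + N / P)) *
          (ENNReal.ofReal (C₂ ^ (1 / P)) * E ^ (1 / P)) := by
          gcongr
          · linarith
          · linarith
          · exact (radialTail_antitone G hr).trans h3
      _ = ENNReal.ofReal (2 ^ (a - 1 + N / P) * C₂ ^ (1 / P)) * E ^ (1 / P) := by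
          rw [← mul_assoc, ← ENNReal.ofReal_mul (by positivity)]
      _ ≤ _ := by
          gcongr
          exact le_add_of_nonneg_left (by positivity)
  · have hr0 : 0 < r := by linarith
    have h3 := rpow_one_div_le_of_rpow_le hP0 hC₁ ((h₁ G hG r hr0).trans
        (mul_le_mul_right (setLIntegral_le_lintegral _ _) _))
    rw [neg_zero, Real.rpow_zero, one_mul, add_zero] at h3
    calc ENNReal.ofReal ((1 + r) ^ (a - 1 + N / P)) * radialTail G r
        ≤ ENNReal.ofReal (2 ^ ((N : ℝ) / P) * (r ^ ((N : ℝ) / P) * (1 + r) ^ (a - 1))) *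
          radialTail G r := by
          gcongr ENNReal.ofReal ?_ * _
          rw [Real.rpow_add (by positivity), mul_comm, ← mul_assoc,
            ← Real.mul_rpow (by positivity) hr]
          gcongr
          linarith
      _ = ENNReal.ofReal (2 ^ ((N : ℝ) / P)) *
          (ENNReal.ofReal (r ^ ((N : ℝ) / P) * (1 + r) ^ (a - 1)) * radialTail G r) := by
          rw [ENNReal.ofReal_mul (by positivity), mul_assoc]
      _ ≤ ENNReal.ofReal (2 ^ ((N : ℝ) / P)) * (ENNReal.ofReal (C₁ ^ (1 / P)) * E ^ (1 / P)) := by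
          gcongr _ * ?_
          exact h3
      _ = ENNReal.ofReal (2 ^ ((N : ℝ) / P) * C₁ ^ (1 / P)) * E ^ (1 / P) := by
          rw [← mul_assoc, ← ENNReal.ofReal_mul (by positivity)]
      _ ≤ _ := by
          gcongr
          exact le_add_of_nonneg_right (by positivity)

/-- The pointwise bound with `θ = 0` involves only the energy outside the ball of radius `r`, which
tends to `0` since the total energy is finite. -/
theorem tendsto_rpow_mul_radialTail (hN : 0 < N) {a P : ℝ} (hP : 1 ≤ P) (ha : 1 < a + N / P)
    {G : RN N → ℝ≥0∞} (hG : Measurable G) (hE : weightedEnergy a P G ≠ ∞) :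
    Tendsto (fun r : ℝ => ENNReal.ofReal (r ^ (a - 1 + N / P)) * radialTail G r) atTop (𝓝 0) := by
  have hP0 : 0 < P := by linarith
  have hNR : (0 : ℝ) < N := by exact_mod_cast hN
  obtain ⟨C₁, hC₁, h₁⟩ := exists_radialTail_rpow_le N hP le_rfl zero_le_one
    (by positivity : (0 : ℝ) < N / P) ha
  set F : RN N → ℝ≥0∞ := fun y => (ENNReal.ofReal ((1 + ‖y‖) ^ a) * G y) ^ P with hF
  have hFm : Measurable F := by fun_prop
  have hlim : Tendsto (fun r : ℝ => ∫⁻ y in {y : RN N | r < ‖y‖}, F y) atTop (𝓝 0) := by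
    have h := tendsto_lintegral_filter_of_dominated_convergence (μ := (volume : Measure (RN N)))
      (l := (atTop : Filter ℝ)) (F := fun r => {y : RN N | r < ‖y‖}.indicator F)
      (f := fun _ => 0) F
      (Eventually.of_forall fun r => hFm.indicator (measurableSet_lt_norm r))
      (Eventually.of_forall fun r => Eventually.of_forall fun y =>
        Set.indicator_le_self _ _ _) hE (Eventually.of_forall fun y => ?_)
    · simpa only [lintegral_indicator (measurableSet_lt_norm _), lintegral_zero] using h
    · refine tendsto_const_nhds.congr' ?_
      filter_upwards [eventually_ge_atTop ‖y‖] with r hr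
      rw [Set.indicator_of_notMem (by exact not_lt.2 hr)]
  have hlim2 : Tendsto (fun r : ℝ => ENNReal.ofReal (2 ^ |a - 1|) *
      (ENNReal.ofReal (C₁ ^ (1 / P)) * (∫⁻ y in {y : RN N | r < ‖y‖}, F y) ^ (1 / P)))
      atTop (𝓝 0) := by
    have h := (ENNReal.continuous_rpow_const (y := 1 / P)).tendsto 0 |>.comp hlim
    rw [ENNReal.zero_rpow_of_pos (by positivity)] at h
    have h2 := ENNReal.Tendsto.const_mul (a := ENNReal.ofReal (C₁ ^ (1 / P))) h
      (Or.inr ENNReal.ofReal_ne_top)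
    rw [mul_zero] at h2
    have h3 := ENNReal.Tendsto.const_mul (a := ENNReal.ofReal (2 ^ |a - 1|)) h2
      (Or.inr ENNReal.ofReal_ne_top)
    rwa [mul_zero] at h3
  refine tendsto_of_tendsto_of_tendsto_of_le_of_le' tendsto_const_nhds hlim2
    (Eventually.of_forall fun r => zero_le) ?_
  filter_upwards [eventually_ge_atTop 1] with r hr1
  have hr0 : 0 < r := by linarith
  have h3 := rpow_one_div_le_of_rpow_le hP0 hC₁ (h₁ G hG r hr0)
  rw [neg_zero, Real.rpow_zero, one_mul, add_zero] at h3
  have h4 : r ^ (a - 1) ≤ 2 ^ |a - 1| * (1 + r) ^ (a - 1) := by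
    rcases le_total 0 (a - 1) with h | h
    · calc r ^ (a - 1) ≤ (1 + r) ^ (a - 1) := by gcongr; linarith
        _ ≤ _ := le_mul_of_one_le_left (by positivity)
          (Real.one_le_rpow (by norm_num) (abs_nonneg _))
    · have h5 := Real.rpow_le_rpow_of_nonpos (by positivity : 0 < (1 + r) / 2)
        (by linarith : (1 + r) / 2 ≤ r) h
      rwa [Real.div_rpow (by positivity) (by norm_num), div_eq_mul_inv,
        ← Real.rpow_neg (by norm_num), mul_comm, ← abs_of_nonpos h] at h5
  calc ENNReal.ofReal (r ^ (a - 1 + N / P)) * radialTail G r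
      ≤ ENNReal.ofReal (2 ^ |a - 1| * (r ^ ((N : ℝ) / P) * (1 + r) ^ (a - 1))) * radialTail G r := by
        gcongr ENNReal.ofReal ?_ * _
        rw [Real.rpow_add hr0, mul_comm, mul_left_comm]
        gcongr
    _ = ENNReal.ofReal (2 ^ |a - 1|) *
        (ENNReal.ofReal (r ^ ((N : ℝ) / P) * (1 + r) ^ (a - 1)) * radialTail G r) := by
        rw [ENNReal.ofReal_mul (by positivity), mul_assoc]
    _ ≤ _ := by gcongr

end WeightedEstimates

/-! ### The weighted spaces and the exclusion of constants -/

section WeightedSpaces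

variable {N : ℕ}

theorem continuous_growthWeight (N : ℕ) (s : ℝ) (q : ℝ≥0∞) : Continuous (growthWeight N s q) :=
  (by fun_prop : Continuous fun x : RN N => 1 + ‖x‖).rpow_const fun x => Or.inl (by positivity)

theorem growthWeight_pos (s : ℝ) (q : ℝ≥0∞) (x : RN N) : 0 < growthWeight N s q x := by
  unfold growthWeight; positivity

theorem eLpNorm_growthWeight_smul {F : Type*} [NormedAddCommGroup F] [NormedSpace ℝ F] (s : ℝ)
    {q : ℝ≥0∞} (hq0 : q ≠ 0) (hq : q ≠ ∞) (f : RN N → F) :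
    eLpNorm (fun x => growthWeight N s q x • f x) q volume =
      weightedEnergy (-s - N / q.toReal) q.toReal (fun x => ‖f x‖ₑ) ^ (1 / q.toReal) := by
  rw [eLpNorm_eq_lintegral_rpow_enorm_toReal hq0 hq, weightedEnergy]
  congr 1
  refine lintegral_congr fun x => ?_
  rw [enorm_smul, Real.enorm_of_nonneg (growthWeight_pos s q x).le, growthWeight]

theorem funNormL_eq_weightedEnergy (s : ℝ) {q : ℝ≥0∞} (hq0 : q ≠ 0) (hq : q ≠ ∞) (f : RN N → ℝ) :
    funNormL s q f =
      weightedEnergy (-s - N / q.toReal) q.toReal (fun x => ‖f x‖ₑ) ^ (1 / q.toReal) :=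
  eLpNorm_growthWeight_smul s hq0 hq f

/-- The weight is continuous and positive, so its inverse is bounded on compact sets and local
integrability is automatic. -/
theorem FunMemL.of_memLp {s : ℝ} {q : ℝ≥0∞} {f : RN N → ℝ} (hf : AEStronglyMeasurable f volume)
    (h : MemLp (fun x => growthWeight N s q x * f x) q volume) : FunMemL s q f := by
  refine ⟨fun K hK => ?_, h⟩
  obtain ⟨M, hM⟩ := hK.exists_bound_of_continuousOn
    ((continuous_growthWeight N s q).inv₀ fun x => (growthWeight_pos s q x).ne').continuousOn
  refine (h.restrict K).of_le_mul (c := M) hf.restrict ?_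
  filter_upwards [ae_restrict_mem hK.measurableSet] with x hx
  have hMx := hM x hx
  have hw := growthWeight_pos s q x
  rw [Pi.inv_apply, norm_inv, Real.norm_of_nonneg hw.le, inv_le_iff_one_le_mul₀ hw] at hMx
  rw [norm_mul, Real.norm_of_nonneg hw.le, ← mul_assoc]
  exact le_mul_of_one_le_left (norm_nonneg _) hMx

/-- This gives uniqueness of `c_u`. For `q = ∞` the weight is unbounded. For finite `q`, the `q`-th
power of the weight is at least `(1 + |x|)^(-N)`, which diverges logarithmically in polar
coordinates. -/
theorem eq_zero_of_memLp_growthWeight_mul_const (hN : 0 < N) {t : ℝ} (ht : t < 0) {q : ℝ≥0∞}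
    (hq1 : 1 ≤ q) {d : ℝ} (h : MemLp (fun x => growthWeight N t q x * d) q volume) : d = 0 := by
  have : Nonempty (Fin N) := ⟨⟨0, hN⟩⟩
  by_contra hd
  have hd0 : 0 < |d| := abs_pos.2 hd
  rcases eq_or_ne q ∞ with rfl | hq
  · have hlim : Tendsto (fun r : ℝ => (1 + r) ^ (-t) * |d|) atTop atTop :=
      ((tendsto_rpow_atTop (by linarith : 0 < -t)).comp
        (tendsto_atTop_add_const_left _ 1 tendsto_id)).atTop_mul_const hd0
    have hess : eLpNormEssSup (fun x => growthWeight N t ∞ x * d) volume < ∞ := by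
      simpa using h.2
    set M := (eLpNormEssSup (fun x => growthWeight N t ∞ x * d) volume).toReal with hM
    have hbound : ∀ᵐ x : RN N, ‖growthWeight N t ∞ x * d‖ ≤ M := by
      filter_upwards [ae_le_eLpNormEssSup (f := fun x => growthWeight N t ∞ x * d)
        (μ := (volume : Measure (RN N)))] with x hx
      rw [hM, ← toReal_enorm]
      exact ENNReal.toReal_mono hess.ne hx
    obtain ⟨r, hr0, hr⟩ := ((eventually_ge_atTop 0).and (hlim.eventually_gt_atTop M)).exists
    have hopen : IsOpen {x : RN N | M < ‖growthWeight N t ∞ x * d‖} :=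
      isOpen_lt continuous_const (((continuous_growthWeight N t ∞).mul continuous_const).norm)
    have hne : {x : RN N | M < ‖growthWeight N t ∞ x * d‖}.Nonempty := by
      refine ⟨EuclideanSpace.single ⟨0, hN⟩ r, ?_⟩
      simp only [Set.mem_ofPred_eq, growthWeight, norm_mul, Real.norm_eq_abs,
        PiLp.norm_single, abs_of_nonneg hr0, ENNReal.toReal_top, div_zero, sub_zero]
      rwa [abs_of_nonneg (by positivity)]
    refine (hopen.measure_pos volume hne).ne' ?_
    rw [ae_iff] at hbound
    simpa only [not_le] using hbound
  · have hq0 : q ≠ 0 := (one_pos.trans_le hq1).ne'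
    have hQ : 0 < q.toReal := ENNReal.toReal_pos hq0 hq
    set Q := q.toReal with hQdef
    have hint := h.integrable_norm_rpow hq0 hq
    simp only [growthWeight, ← hQdef] at hint
    rw [integrable_fun_norm_addHaar volume
      (f := fun r : ℝ => ‖(1 + r) ^ (-t - N / Q) * d‖ ^ Q), finrank_euclideanSpace_fin] at hint
    have hint1 := hint.mono_set (Set.Ioi_subset_Ioi (zero_le_one' ℝ))
    have hc : 0 < (2 : ℝ) ^ (-(N : ℝ)) * |d| ^ Q := by positivity
    have hinv : IntegrableOn (fun r : ℝ => (2 : ℝ) ^ (-(N : ℝ)) * |d| ^ Q * r ^ (-1 : ℝ))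
        (Set.Ioi 1) := by
      refine hint1.mono' (Measurable.aestronglyMeasurable (by fun_prop)) ?_
      filter_upwards [ae_restrict_mem measurableSet_Ioi] with r hr
      have hr1 : 1 < r := hr
      have hr0 : 0 < r := by linarith
      rw [Real.norm_of_nonneg (by positivity), smul_eq_mul, norm_mul,
        Real.norm_of_nonneg (by positivity), Real.norm_eq_abs,
        Real.mul_rpow (by positivity) hd0.le, ← Real.rpow_mul (by positivity), ← mul_assoc,
        mul_right_comm]
      gcongr ?_ * _
      calc (2 : ℝ) ^ (-(N : ℝ)) * r ^ (-1 : ℝ) = r ^ (N - 1) * (2 * r) ^ (-(N : ℝ)) := by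
            rw [Real.mul_rpow (by norm_num) hr0.le, mul_left_comm, Real.rpow_neg_one,
              Real.rpow_neg hr0.le, Real.rpow_natCast]
            congr 1
            have : r ^ N = r ^ (N - 1) * r := by rw [← pow_succ, Nat.sub_add_cancel hN]
            rw [this]
            field_simp
        _ ≤ r ^ (N - 1) * (1 + r) ^ (-(N : ℝ)) := by
            gcongr _ * ?_
            exact Real.rpow_le_rpow_of_nonpos (by positivity) (by linarith) (by simp)
        _ ≤ _ := by
            gcongr _ * ?_
            refine Real.rpow_le_rpow_of_exponent_le (by linarith) ?_
            rw [sub_mul, div_mul_cancel₀ _ hQ.ne']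
            nlinarith
    have h1 := (integrable_const_mul_iff (IsUnit.mk0 _ hc.ne') _).1 hinv
    exact absurd ((integrableOn_Ioi_rpow_iff one_pos).1 h1) (lt_irrefl _)

end WeightedSpaces

/-! ### From distributions to functions, and the final estimates -/

section Representation

variable {N : ℕ}

theorem Represents.congr {T : Distr N} {f f' : RN N → ℝ} (h : Represents T f)
    (hff' : f =ᵐ[volume] f') : Represents T f' := by
  have hl : LocallyIntegrable f' volume := h.1.congr hff'
  refine ⟨hl, ?_⟩
  rw [h.2]
  ext φ
  rw [distrOfFun_apply h.1, distrOfFun_apply hl]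
  refine integral_congr_ae ?_
  filter_upwards [hff'] with x hx
  rw [hx]

theorem Represents.sub {T S : Distr N} {f f' : RN N → ℝ} (hT : Represents T f)
    (hS : Represents S f') : Represents (T - S) (fun x => f x - f' x) := by
  have hl : LocallyIntegrable (fun x => f x - f' x) volume := hT.1.sub hS.1
  refine ⟨hl, ?_⟩
  ext φ
  change T φ - S φ = _
  rw [hT.2, hS.2, distrOfFun_apply hT.1, distrOfFun_apply hS.1, distrOfFun_apply hl,
    ← integral_sub (integrable_testFunction_mul hT.1 φ) (integrable_testFunction_mul hS.1 φ)]
  simp only [mul_sub]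

theorem represents_constDistr (c : ℝ) : Represents (constDistr N c) (fun _ => c) :=
  ⟨locallyIntegrable_const c, rfl⟩

theorem eq_of_memL_sub_constDistr (hN : 0 < N) {t : ℝ} (ht : t < 0) {q : ℝ≥0∞} (hq1 : 1 ≤ q)
    {u : Distr N} {c c' : ℝ} (h : MemL t q (u - constDistr N c))
    (h' : MemL t q (u - constDistr N c')) : c' = c := by
  obtain ⟨f, hf, -, hfL⟩ := h
  obtain ⟨f', hf', -, hfL'⟩ := h'
  have h1 := hf.sub hf'
  have h2 : Represents (u - constDistr N c - (u - constDistr N c')) (fun _ => c' - c) := by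
    rw [sub_sub_sub_cancel_left]
    exact (represents_constDistr c').sub (represents_constDistr c)
  have h3 := h1.ae_eq h2
  have h4 := hfL.sub hfL'
  have h5 : MemLp (fun x => growthWeight N t q x * (c' - c)) q volume := by
    refine (memLp_congr_ae ?_).1 h4
    filter_upwards [h3] with x hx
    rw [Pi.sub_apply, ← mul_sub, hx]
  linarith [eq_zero_of_memLp_growthWeight_mul_const hN ht hq1 h5]

theorem GradMemL.exists_gradRepresents {s : ℝ} {p : ℝ≥0∞} (hp0 : p ≠ 0) (hp : p ≠ ∞)
    {u : Distr N} (hu : GradMemL s p u) :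
    ∃ g : RN N → RN N, Measurable g ∧ GradRepresents u g ∧
      weightedEnergy (-s - N / p.toReal) p.toReal (fun y => ‖g y‖ₑ) ≠ ∞ := by
  have hP : 0 < p.toReal := ENNReal.toReal_pos hp0 hp
  choose f hf hfL using hu
  have hfm : ∀ i, AEStronglyMeasurable (f i) volume := fun i => (hf i).1.aestronglyMeasurable
  -- Everywhere measurable representatives are chosen, so that `(x, t) ↦ g (t • x)` is jointly
  -- measurable.
  set g : RN N → RN N := fun x => WithLp.toLp 2 fun i => (hfm i).mk (f i) x with hg
  have hgi : ∀ i, f i =ᵐ[volume] fun x => g x i := fun i => (hfm i).ae_eq_mk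
  have hgm : Measurable g := by
    refine (PiLp.continuous_toLp 2 (fun _ : Fin N => ℝ)).measurable.comp ?_
    exact measurable_pi_lambda _ fun i => (hfm i).stronglyMeasurable_mk.measurable
  refine ⟨g, hgm, fun i => (hf i).congr (hgi i), ?_⟩
  have hmem : MemLp (fun x => growthWeight N s p x • g x) p volume := by
    have h1 : (fun x => growthWeight N s p x • g x) = ∑ i, fun x =>
        (growthWeight N s p x * g x i) • (EuclideanSpace.single i (1 : ℝ) : RN N) := by
      ext1 x
      rw [Finset.sum_apply]
      simp only [mul_smul, ← Finset.smul_sum]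
      rw [sum_smul_single]
    rw [h1]
    refine memLp_finsetSum' _ fun i _ => ?_
    have h2 : MemLp (fun x => growthWeight N s p x * g x i) p volume := by
      refine (memLp_congr_ae ?_).1 (hfL i).2
      filter_upwards [hgi i] with x hx
      rw [hx]
    refine h2.of_le_mul (c := 1) ?_ (Eventually.of_forall fun x => ?_)
    · exact h2.1.smul_const _
    · rw [norm_smul, PiLp.norm_single, norm_one, mul_one, one_mul]
  have h3 := hmem.2
  rw [eLpNorm_growthWeight_smul s hp0 hp] at h3
  intro htop
  rw [htop, ENNReal.top_rpow_of_pos (by positivity)] at h3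
  exact lt_irrefl _ h3

theorem gradNormL_eq_weightedEnergy {s : ℝ} {p : ℝ≥0∞} (hp0 : p ≠ 0) (hp : p ≠ ∞)
    {u : Distr N} {g : RN N → RN N} (hg : GradRepresents u g) :
    gradNormL s p u =
      weightedEnergy (-s - N / p.toReal) p.toReal (fun y => ‖g y‖ₑ) ^ (1 / p.toReal) := by
  rw [gradNormL_eq hg, funNormL_eq_weightedEnergy s hp0 hp]
  simp only [enorm_norm]

/-- The properties of a distribution with gradient in `L^p_s` from which all estimates follow:
`u - c` is the function `rayPrimitive g`, where `g` is the gradient of `u`. -/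
structure IsRayPrimitive (s : ℝ) (p : ℝ≥0∞) (u : Distr N) (c : ℝ) (g : RN N → RN N) : Prop where
  measurable : Measurable g
  gradRepresents : GradRepresents u g
  energy_ne_top : weightedEnergy (-s - N / p.toReal) p.toReal (fun y => ‖g y‖ₑ) ≠ ∞
  represents : Represents (u - constDistr N c) (rayPrimitive g)

theorem GradMemL.exists_isRayPrimitive (hN : 1 < N) {s : ℝ} (hs : s < -1) {p : ℝ≥0∞}
    (hp1 : 1 ≤ p) (hp : p ≠ ∞) {u : Distr N} (hu : GradMemL s p u) :
    ∃ c g, IsRayPrimitive s p u c g := by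
  have hp0 : p ≠ 0 := (one_pos.trans_le hp1).ne'
  have hP1 : 1 ≤ p.toReal := by
    rw [← ENNReal.toReal_one]; exact ENNReal.toReal_mono hp hp1
  obtain ⟨g, hg, hgu, hE⟩ := hu.exists_gradRepresents hp0 hp
  have ha : 1 < -s - N / p.toReal + N / p.toReal := by linarith
  have hN0 : 0 < N := by omega
  obtain ⟨c, hc⟩ := hgu.exists_sub_const_eq hN hg
    (radialTail_ne_top hN0 hP1 ha hg.enorm hE one_pos)
    (fun K hK => setLIntegral_rayTail_ne_top hN0 hP1 ha hg.enorm hE hK)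
  exact ⟨c, g, hg, hgu, hE, hc⟩

variable {s : ℝ} {p : ℝ≥0∞} {u : Distr N} {c : ℝ} {g : RN N → RN N}

theorem IsRayPrimitive.normL_eq (h : IsRayPrimitive s p u c g) (t : ℝ) (q : ℝ≥0∞) :
    normL t q (u - constDistr N c) = funNormL t q (rayPrimitive g) :=
  _root_.normL_eq h.represents t q

theorem IsRayPrimitive.memL (h : IsRayPrimitive s p u c g) {t : ℝ} {q : ℝ≥0∞}
    (hq : normL t q (u - constDistr N c) ≠ ∞) : MemL t q (u - constDistr N c) := by
  rw [h.normL_eq] at hq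
  have hm := measurable_rayPrimitive h.measurable
  refine ⟨_, h.represents, FunMemL.of_memLp hm.aestronglyMeasurable ⟨?_, hq.lt_top⟩⟩
  exact ((continuous_growthWeight N t q).measurable.mul hm).aestronglyMeasurable

theorem IsRayPrimitive.gradNormL_ne_top (h : IsRayPrimitive s p u c g) (hp0 : p ≠ 0)
    (hp : p ≠ ∞) : gradNormL s p u ≠ ∞ := by
  rw [gradNormL_eq_weightedEnergy hp0 hp h.gradRepresents]
  exact ENNReal.rpow_ne_top_of_nonneg (by positivity) h.energy_ne_top

theorem IsRayPrimitive.memL_of_le (h : IsRayPrimitive s p u c g) (hp0 : p ≠ 0)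
    (hp : p ≠ ∞) {t C : ℝ} {q : ℝ≥0∞}
    (hC : normL t q (u - constDistr N c) ≤ ENNReal.ofReal C * gradNormL s p u) :
    MemL t q (u - constDistr N c) :=
  h.memL (ne_top_of_le_ne_top
    (ENNReal.mul_ne_top ENNReal.ofReal_ne_top (h.gradNormL_ne_top hp0 hp)) hC)

theorem exists_normL_le (hN : 1 < N) (hs : s < -1) (hp1 : 1 ≤ p) (hp : p ≠ ∞) :
    ∃ C : ℝ, 0 < C ∧ ∀ (u : Distr N) c g, IsRayPrimitive s p u c g →
      normL (s + 1) p (u - constDistr N c) ≤ ENNReal.ofReal C * gradNormL s p u := by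
  have hp0 : p ≠ 0 := (one_pos.trans_le hp1).ne'
  have hP1 : 1 ≤ p.toReal := by
    rw [← ENNReal.toReal_one]; exact ENNReal.toReal_mono hp hp1
  obtain ⟨C, hC, h⟩ := exists_rayTail_energy_le (N := N) (by omega)
    (a := -s - N / p.toReal) hP1 (by linarith)
  refine ⟨C, hC, fun u c g hg => ?_⟩
  rw [hg.normL_eq, gradNormL_eq_weightedEnergy hp0 hp hg.gradRepresents,
    funNormL_eq_weightedEnergy _ hp0 hp,
    show -(s + 1) - N / p.toReal = -s - N / p.toReal - 1 by ring]
  exact h _ _ hg.measurable.enorm (Eventually.of_forall (enorm_rayPrimitive_le g))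

theorem IsRayPrimitive.ae_eq_radialPrimitive (hN : 1 < N) (hs : s < -1) (hp1 : 1 ≤ p)
    (hp : p ≠ ∞) (h : IsRayPrimitive s p u c g) (hr : IsRadial u) :
    ∀ᵐ x : RN N, rayPrimitive g x = radialPrimitive g ‖x‖ := by
  have hP1 : 1 ≤ p.toReal := by
    rw [← ENNReal.toReal_one]; exact ENNReal.toReal_mono hp hp1
  obtain ⟨k, hk⟩ := hr
  have h1 := h.represents.ae_eq (hk.sub (represents_constDistr c))
  exact rayPrimitive_ae_eq_radialPrimitive (by omega) h.measurable
    (fun r hr => radialTail_ne_top (by omega) hP1 (by linarith) h.measurable.enorm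
      h.energy_ne_top hr) (h := fun r => k r - c) h1

/-- The estimates use the interval only through these facts. The last one is the Sobolev condition,
`θ ≤ 1` for `θ = N/P - N/Q`. -/
theorem exponent_bounds_of_mem_sobolevInterval {q : ℝ≥0∞} (hp1 : 1 ≤ p) (hp : p ≠ ∞)
    (hN : 1 < N) (hq : q ∈ sobolevInterval N p) :
    p ≤ q ∧ (q = ∞ → (N : ℝ) < p.toReal) ∧
      (q ≠ ∞ → (N : ℝ) / p.toReal - N / q.toReal ≤ 1) := by
  have hp0 : p ≠ 0 := (one_pos.trans_le hp1).ne'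
  have hP0 : 0 < p.toReal := ENNReal.toReal_pos hp0 hp
  have hNR : (0 : ℝ) < N := by positivity
  rcases lt_trichotomy p N with h | h | h
  · have hPN : p.toReal < N := by
      have := ENNReal.toReal_strict_mono (ENNReal.natCast_ne_top N) h
      simpa using this
    rw [sobolevInterval, if_pos (Or.inl h.ne), sobolevExp, if_pos h] at hq
    have hexp : (N * p / (N - p) : ℝ≥0∞) ≠ ∞ :=
      ENNReal.div_ne_top (ENNReal.mul_ne_top (ENNReal.natCast_ne_top N) hp)
        (tsub_pos_of_lt h).ne'
    refine ⟨hq.1, fun h' => absurd hq.2 (by rw [h']; simpa using hexp), fun hqt => ?_⟩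
    have hQ0 : 0 < q.toReal := hP0.trans_le (ENNReal.toReal_mono hqt hq.1)
    have h2 := ENNReal.toReal_mono hexp hq.2
    rw [ENNReal.toReal_div, ENNReal.toReal_mul, ENNReal.toReal_sub_of_le h.le
      (ENNReal.natCast_ne_top N), ENNReal.toReal_natCast, le_div_iff₀ (by linarith)] at h2
    rw [div_sub_div _ _ hP0.ne' hQ0.ne', div_le_one (by positivity)]
    linarith
  · rw [sobolevInterval, if_neg (by simp [h]; omega)] at hq
    refine ⟨hq.1, fun h' => absurd hq.2 (by simp [h']), fun hqt => ?_⟩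
    have hPN : p.toReal = N := by rw [h]; simp
    rw [hPN, div_self hNR.ne']
    have : 0 ≤ (N : ℝ) / q.toReal := by positivity
    linarith
  · have hPN : (N : ℝ) < p.toReal := by
      have := ENNReal.toReal_strict_mono hp h
      simpa using this
    rw [sobolevInterval, if_pos (Or.inl h.ne')] at hq
    refine ⟨hq.1, fun _ => hPN, fun _ => ?_⟩
    have : 0 ≤ (N : ℝ) / q.toReal := by positivity
    have : (N : ℝ) / p.toReal ≤ 1 := by rw [div_le_one hP0]; exact hPN.le
    linarith

theorem exists_normL_le_of_isRadial (hN : 1 < N) (hs : s < -1) (hp1 : 1 ≤ p) (hp : p ≠ ∞)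
    {q : ℝ≥0∞} (hq : q ∈ sobolevInterval N p) :
    ∃ C : ℝ, 0 < C ∧ ∀ (u : Distr N) c g, IsRayPrimitive s p u c g → IsRadial u →
      normL (s + 1) q (u - constDistr N c) ≤ ENNReal.ofReal C * gradNormL s p u := by
  have hp0 : p ≠ 0 := (one_pos.trans_le hp1).ne'
  have hP1 : 1 ≤ p.toReal := by
    rw [← ENNReal.toReal_one]; exact ENNReal.toReal_mono hp hp1
  have hN0 : 0 < N := by omega
  obtain ⟨hpq, htop, hfin⟩ := exponent_bounds_of_mem_sobolevInterval hp1 hp hN hq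
  have ha : 1 < -s - N / p.toReal + N / p.toReal := by linarith
  have hv : ∀ {u : Distr N} {c : ℝ} {g : RN N → RN N}, IsRayPrimitive s p u c g → IsRadial u →
      ∀ᵐ x, ‖rayPrimitive g x‖ₑ ≤
        ENNReal.ofReal (sphereMass N)⁻¹ * radialTail (fun y => ‖g y‖ₑ) ‖x‖ := by
    intro u c g hg hu
    filter_upwards [hg.ae_eq_radialPrimitive hN hs hp1 hp hu] with x hx
    rw [hx]
    exact enorm_radialPrimitive_le g ‖x‖
  rcases eq_or_ne q ∞ with rfl | hqt
  · obtain ⟨C, hC, h⟩ := exists_weight_mul_radialTail_le hN0 hP1 (htop rfl) ha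
    have hσ := sphereMass_pos hN0
    refine ⟨(sphereMass N)⁻¹ * C, by positivity, fun u c g hg hu => ?_⟩
    rw [hg.normL_eq, gradNormL_eq_weightedEnergy hp0 hp hg.gradRepresents, funNormL,
      eLpNorm_exponent_top]
    refine essSup_le_of_ae_le _ ?_
    filter_upwards [hv hg hu] with x hx
    have h1 := h _ hg.measurable.enorm ‖x‖ (norm_nonneg x)
    rw [show -s - N / p.toReal - 1 + N / p.toReal = -(s + 1) by ring] at h1
    rw [enorm_mul, Real.enorm_of_nonneg (growthWeight_pos _ _ x).le, growthWeight,
      ENNReal.toReal_top, div_zero, sub_zero, ENNReal.ofReal_mul (by positivity), mul_assoc]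
    refine (mul_le_mul_right hx _).trans ?_
    rw [mul_left_comm]
    gcongr _ * ?_
  · have hq0 : q ≠ 0 := (one_pos.trans_le (hp1.trans hpq)).ne'
    obtain ⟨C, hC, h⟩ := exists_radial_energy_le hN0 (σ := (sphereMass N)⁻¹) hP1
      (ENNReal.toReal_mono hqt hpq) (hfin hqt) ha
    refine ⟨C, hC, fun u c g hg hu => ?_⟩
    rw [hg.normL_eq, gradNormL_eq_weightedEnergy hp0 hp hg.gradRepresents,
      funNormL_eq_weightedEnergy _ hq0 hqt, show -(s + 1) - N / q.toReal =
        -s - N / p.toReal - 1 + N / p.toReal - N / q.toReal by ring]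
    exact h _ _ hg.measurable.enorm (Eventually.of_forall (enorm_rayPrimitive_le g)) (hv hg hu)

theorem IsRayPrimitive.exists_continuous (hN : 1 < N) (hs : s < -1) (hp1 : 1 ≤ p)
    (hp : p ≠ ∞) (hNp : (N : ℝ≥0∞) < p) (h : IsRayPrimitive s p u c g) (hr : IsRadial u) :
    ∃ f : RN N → ℝ, Continuous f ∧ Represents u f ∧
      Tendsto (fun x => ‖x‖ ^ (-(s + 1)) * (f x - c)) (comap norm atTop) (𝓝 0) := by
  have hp0 : p ≠ 0 := (one_pos.trans_le hp1).ne'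
  have hP1 : 1 ≤ p.toReal := by
    rw [← ENNReal.toReal_one]; exact ENNReal.toReal_mono hp hp1
  have hN0 : 0 < N := by omega
  have ha : 1 < -s - N / p.toReal + N / p.toReal := by linarith
  have hPN : (N : ℝ) < p.toReal := by
    have := ENNReal.toReal_strict_mono hp hNp
    simpa using this
  have hA : radialTail (fun y => ‖g y‖ₑ) 0 ≠ ∞ := by
    obtain ⟨C, hC, h1⟩ := exists_radialTail_zero_rpow_le N hP1 hN0 hPN ha
    have h2 := rpow_one_div_le_of_rpow_le (by linarith) hC (h1 _ h.measurable.enorm)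
    refine ne_top_of_le_ne_top (ENNReal.mul_ne_top ENNReal.ofReal_ne_top ?_) h2
    exact ENNReal.rpow_ne_top_of_nonneg (by positivity) h.energy_ne_top
  refine ⟨fun x => radialPrimitive g ‖x‖ + c,
    (continuous_radialPrimitive_norm hN0 h.measurable hA).add continuous_const, ?_, ?_⟩
  -- The constant `c` is added back by subtracting the constant distribution `-c`.
  · have h1 := (h.represents.congr (h.ae_eq_radialPrimitive hN hs hp1 hp hr)).sub
      (represents_constDistr (-c))
    have h2 : u - constDistr N c - constDistr N (-c) = u := by
      ext φ
      change u φ - constDistr N c φ - constDistr N (-c) φ = u φ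
      rw [constDistr_apply, constDistr_apply]
      ring
    rw [h2] at h1
    simpa only [sub_neg_eq_add] using h1
  · simp only [add_sub_cancel_right]
    have hlim := tendsto_rpow_mul_radialTail hN0 hP1 ha h.measurable.enorm h.energy_ne_top
    have hlim2 := ENNReal.Tendsto.const_mul (a := ENNReal.ofReal (sphereMass N)⁻¹) hlim
      (Or.inr ENNReal.ofReal_ne_top)
    rw [mul_zero] at hlim2
    have hlim3 := hlim2.comp (tendsto_comap (f := fun x : RN N => ‖x‖) (x := atTop))
    rw [tendsto_zero_iff_enorm_tendsto_zero]
    refine tendsto_of_tendsto_of_tendsto_of_le_of_le tendsto_const_nhds hlim3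
      (fun x => zero_le) fun x => ?_
    simp only [Function.comp]
    rw [enorm_mul, Real.enorm_of_nonneg (by positivity), mul_left_comm,
      show -s - N / p.toReal - 1 + N / p.toReal = -(s + 1) by ring]
    gcongr _ * ?_
    exact enorm_radialPrimitive_le g ‖x‖

end Representation

theorem theorem5 (N : ℕ) (hN : 1 < N) (s : ℝ) (hs : s < -1)
    (p : ℝ≥0∞) (hp1 : 1 ≤ p) (hp : p ≠ ∞) :
    ∃ c : Distr N → ℝ,
      -- (i)
      (∀ u : Distr N, GradMemL s p u →
        MemL (s + 1) p (u - constDistr N (c u)) ∧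
        ∀ c' : ℝ, MemL (s + 1) p (u - constDistr N c') → c' = c u) ∧
      (∃ C : ℝ, 0 < C ∧ ∀ u : Distr N, GradMemL s p u →
        normL (s + 1) p (u - constDistr N (c u)) ≤ ENNReal.ofReal C * gradNormL s p u) ∧
      -- (ii)
      (∀ q ∈ sobolevInterval N p,
        (∀ u : Distr N, GradMemL s p u → IsRadial u →
          MemL (s + 1) q (u - constDistr N (c u)) ∧
          ∀ c' : ℝ, MemL (s + 1) q (u - constDistr N c') → c' = c u) ∧
        (∃ C : ℝ, 0 < C ∧ ∀ u : Distr N, GradMemL s p u → IsRadial u →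
          normL (s + 1) q (u - constDistr N (c u)) ≤ ENNReal.ofReal C * gradNormL s p u)) ∧
      -- the pointwise statement, for the continuous representative of `u`
      ((N : ℝ≥0∞) < p → ∀ u : Distr N, GradMemL s p u → IsRadial u →
        ∃ f : RN N → ℝ, Continuous f ∧ Represents u f ∧
          Tendsto (fun x => ‖x‖ ^ (-(s + 1)) * (f x - c u)) (comap norm atTop) (𝓝 0)) := by
  classical
  have hp0 : p ≠ 0 := (one_pos.trans_le hp1).ne'
  have hN0 : 0 < N := by omega
  have ht : s + 1 < 0 := by linarith
  -- The constant is chosen before any exponent `q`, so the same `c u` serves (i) and every case of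
  -- (ii). Distributions without the gradient condition get the irrelevant value `0`.
  have hex : ∀ u : Distr N, ∃ c : ℝ, GradMemL s p u → ∃ g, IsRayPrimitive s p u c g := by
    intro u
    by_cases hu : GradMemL s p u
    · obtain ⟨c, hc⟩ := hu.exists_isRayPrimitive hN hs hp1 hp
      exact ⟨c, fun _ => hc⟩
    · exact ⟨0, fun h => absurd h hu⟩
  choose c hc using hex
  obtain ⟨C, hC, hle⟩ := exists_normL_le hN hs hp1 hp
  refine ⟨c, fun u hu => ?_, ⟨C, hC, fun u hu => ?_⟩, fun q hq => ⟨fun u hu hr => ?_, ?_⟩,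
    fun hNp u hu hr => ?_⟩
  · obtain ⟨g, hg⟩ := hc u hu
    have hm := hg.memL_of_le hp0 hp (hle u _ g hg)
    exact ⟨hm, fun c' hc' => eq_of_memL_sub_constDistr hN0 ht hp1 hm hc'⟩
  · obtain ⟨g, hg⟩ := hc u hu
    exact hle u _ g hg
  · obtain ⟨g, hg⟩ := hc u hu
    obtain ⟨D, -, hD⟩ := exists_normL_le_of_isRadial hN hs hp1 hp hq
    have hm := hg.memL_of_le hp0 hp (hD u _ g hg hr)
    have hpq := (exponent_bounds_of_mem_sobolevInterval hp1 hp hN hq).1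
    exact ⟨hm, fun c' hc' => eq_of_memL_sub_constDistr hN0 ht (hp1.trans hpq) hm hc'⟩
  · obtain ⟨D, hD0, hD⟩ := exists_normL_le_of_isRadial hN hs hp1 hp hq
    refine ⟨D, hD0, fun u hu hr => ?_⟩
    obtain ⟨g, hg⟩ := hc u hu
    exact hD u _ g hg hr
  · obtain ⟨g, hg⟩ := hc u hu
    exact hg.exists_continuous hN hs hp1 hp hNp hr
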